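/- Let $\mathfrak g$ be a finite-dimensional complex simple Lie algebra with Killing form $\langle\cdot,\cdot\rangle$, let $\mathfrak h\subset\mathfrak g$ be a Cartan subalgebra, and fix a base $\{\alpha_1,\dots,\alpha_n\}$ of the root system, with positive roots $\Delta_+$. Choose root vectors $E_\alpha\in\mathfrak g_\alpha$ with $\langle E_\alpha,E_{-\alpha}\rangle=1$ and put $r_0=\sum_{\alpha\in\Delta_+}E_\alpha\wedge E_{-\alpha}$. Let $h_i=[E_{\alpha_i},E_{-\alpha_i}]$, a basis of $\mathfrak h$, let $(h_i^*)$ be the dual basis of $\mathfrak h^*$, and let $(\lambda_1,\dots,\lambda_n)$ be the coordinates on $\mathfrak h^*$ given by $\lambda=\sum_i\lambda_ih_i^*$. Let $U\subset\mathfrak h^*$ be open, and let $A=TU\times\mathfrak g\cong U\times(\mathfrak h^*\oplus\mathfrak g)$ be the gauge Lie algebroid, with anchor the projection to $TU$ and bracket of sections $$[X+\xi,\,Y+\eta]=[X,Y]+[\xi,\eta]+L_X\eta-L_Y\xi$$ for vector fields $X,Y$ on $U$ and $\mathfrak g$-valued functions $\xi,\eta$ on $U$; extend it to the Schouten bracket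 on $\Gamma(\wedge^*A)$. Equip $A^*=T^*U\times\mathfrak g^*$ with the product Lie algebroid structure, where $T^*U$ is the trivial Lie algebroid (zero bracket and anchor) and $\mathfrak g^*$ has the bracket induced by $r_0$, $[\xi,\eta]=L_{r_0^\#\xi}\eta-L_{r_0^\#\eta}\xi$, with $L$ the coadjoint action and $r_0^\#\xi=r_0(\xi,\cdot)$. Let $d_*$ be the differential of the Lie algebroid $A^*$ on $\Gamma(\wedge^*A)$. A section $H$ of $\wedge^2A$ is called a Hamiltonian operator of the coboundary Lie bialgebroid $(A,A^*,r_0)$ if $d_*H+\tfrac12[H,H]=0$ on $U$. A holomorphic function $r:U\to\wedge^2\mathfrak g$ is called a dynamical $r$-matrix (with coupling constant $2$) if $[h,r(\lambda)]=0$ for all $h\in\mathfrak h$ and $\lambda\in U$, and $$\mathrm{Alt}(dr)+\tfrac12[r,r]=[\Omega^{12},\Omega^{23}]\quad\text{on } U,\qquad \mathrm{Alt}(dr)=\sum_{i=1}^n h_i\wedge\frac{\partial r}{\partial\lambda_i},$$ where $\Omega\in(S^2\mathfrak g)^{\mathfrak g}$ is the Casimir element of the Killing form, $[r,r]$ is the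 pointwise Schouten bracket on $\wedge^*\mathfrak g$, and $\wedge^3\mathfrak g\subset\mathfrak g^{\otimes3}$ via $x_1\wedge x_2\wedge x_3=\sum_\sigma\operatorname{sgn}(\sigma)\,x_{\sigma(1)}\otimes x_{\sigma(2)}\otimes x_{\sigma(3)}$. **Theorem.** Let $\theta=\sum_{i=1}^n h_i\wedge\frac{\partial}{\partial\lambda_i}$, a constant section of $\wedge^2A$, and let $\tau:U\to\wedge^2\mathfrak g$ be holomorphic, considered as a section of $\wedge^2A$. Then $\theta+\tau$ is a Hamiltonian operator of $(A,A^*,r_0)$ if and only if $r=r_0+\tau$ is a dynamical $r$-matrix. -/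

import Mathlib

noncomputable section

namespace DynR

open scoped TensorProduct
open LieAlgebra LieAlgebra.IsKilling LieModule Module

/-! ### Multilinear algebra of `⋀² V` and `⋀³ V` for a finite-dimensional complex space `V` -/

section Multilinear

variable {V : Type*} [AddCommGroup V] [Module ℂ V]

/-- The decomposable bivector `u ∧ v`. -/
def wedge2 (u v : V) : ⋀[ℂ]^2 V := exteriorPower.ιMulti ℂ 2 ![u, v]

/-- The decomposable trivector `u ∧ v ∧ w`. -/
def wedge3 (u v w : V) : ⋀[ℂ]^3 V := exteriorPower.ιMulti ℂ 3 ![u, v, w]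

/-- The value `P(ξ, η)` of a bivector on two covectors:
`(u ∧ v)(ξ, η) = ξ(u) η(v) - ξ(v) η(u)`. -/
def ev2 (P : ⋀[ℂ]^2 V) (ξ η : Dual ℂ V) : ℂ :=
  exteriorPower.pairingDual ℂ V 2 (exteriorPower.ιMulti ℂ 2 ![ξ, η]) P

theorem ev2_wedge2 (u v : V) (ξ η : Dual ℂ V) :
    ev2 (wedge2 u v) ξ η = ξ u * η v - ξ v * η u := by
  simp [ev2, wedge2, Matrix.det_fin_two]
  ring

variable [Module.Finite ℂ V]

/-- The coefficient `P^{ab} = P(eᵃ, eᵇ)` of a bivector in a fixed basis `e` of `V`, so that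
`P = ½ ∑ P^{ab} e_a ∧ e_b`. -/
def coeff2 (P : ⋀[ℂ]^2 V) (a b : Fin (finrank ℂ V)) : ℂ :=
  ev2 P ((finBasis ℂ V).coord a) ((finBasis ℂ V).coord b)

/-- `extend2 f P = ½ ∑ P^{ab} f(e_a, e_b)`. If `f` is bilinear and alternating, this is the value
at `P` of the linear map on `⋀² V` that takes `u ∧ v` to `f(u, v)` (see `extend2_wedge2`). -/
def extend2 {W : Type*} [AddCommGroup W] [Module ℂ W] (f : V → V → W) (P : ⋀[ℂ]^2 V) : W :=
  (1 / 2 : ℂ) • ∑ a, ∑ b, coeff2 P a b • f (finBasis ℂ V a) (finBasis ℂ V b)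

theorem extend2_wedge2 {W : Type*} [AddCommGroup W] [Module ℂ W] (f : V →ₗ[ℂ] V →ₗ[ℂ] W)
    (hf : ∀ x, f x x = 0) (u v : V) : extend2 (fun x y => f x y) (wedge2 u v) = f u v := by
  have key : ∀ x y : V, f x y = ∑ a, ∑ b,
      ((finBasis ℂ V).repr x a * (finBasis ℂ V).repr y b) •
        f (finBasis ℂ V a) (finBasis ℂ V b) := by
    intro x y
    conv_lhs => rw [← (finBasis ℂ V).sum_repr x, ← (finBasis ℂ V).sum_repr y]
    simp only [map_sum, LinearMap.sum_apply, map_smul, LinearMap.smul_apply, Finset.smul_sum,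
      mul_smul]
    rw [Finset.sum_comm]
    exact Finset.sum_congr rfl fun a _ => Finset.sum_congr rfl fun b _ => smul_comm _ _ _
  have hs : f v u = - f u v := by
    have h := hf (u + v)
    simp only [map_add, LinearMap.add_apply, hf, zero_add, add_zero] at h
    exact eq_neg_of_add_eq_zero_left h
  simp only [extend2, coeff2, ev2_wedge2, Basis.coord_apply, sub_smul, Finset.sum_sub_distrib]
  rw [← key u v]
  have : ∑ a, ∑ b, ((finBasis ℂ V).repr v a * (finBasis ℂ V).repr u b) •
        f (finBasis ℂ V a) (finBasis ℂ V b) = f v u := (key v u).symm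
  rw [this, hs, sub_neg_eq_add, ← two_smul ℂ, smul_smul]
  norm_num

/-- The exterior product `u ∧ P` of a vector and a bivector. -/
def wedge12 (u : V) (P : ⋀[ℂ]^2 V) : ⋀[ℂ]^3 V := extend2 (fun a b => wedge3 u a b) P

/-- The bundle map `P^♯ : V* → V`, `(P^♯ ξ)(η) = P(ξ, η)`;
`(u ∧ v)^♯ ξ = ξ(u) v - ξ(v) u`. -/
def sharp (P : ⋀[ℂ]^2 V) (ξ : Dual ℂ V) : V := extend2 (fun a b => ξ a • b - ξ b • a) P

end Multilinear

/-! ### The Lie algebra `𝔤`: action on bivectors, Schouten bracket, dual bracket, Casimir -/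

section LieAlg

variable {𝔤 : Type*} [LieRing 𝔤] [LieAlgebra ℂ 𝔤] [Module.Finite ℂ 𝔤]

/-- The adjoint action on bivectors, `[x, a ∧ b] = [x, a] ∧ b + a ∧ [x, b]`. -/
def adBivector (x : 𝔤) (P : ⋀[ℂ]^2 𝔤) : ⋀[ℂ]^2 𝔤 :=
  extend2 (fun a b => wedge2 ⁅x, a⁆ b + wedge2 a ⁅x, b⁆) P

/-- The Schouten bracket `⋀² 𝔤 × ⋀² 𝔤 → ⋀³ 𝔤`,
`[a ∧ b, c ∧ d] = [a, c] ∧ b ∧ d - [a, d] ∧ b ∧ c - [b, c] ∧ a ∧ d + [b, d] ∧ a ∧ c`. -/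
def schoutenLie (P Q : ⋀[ℂ]^2 𝔤) : ⋀[ℂ]^3 𝔤 :=
  extend2 (fun a b => extend2 (fun c d =>
    wedge3 ⁅a, c⁆ b d - wedge3 ⁅a, d⁆ b c - wedge3 ⁅b, c⁆ a d + wedge3 ⁅b, d⁆ a c) Q) P

/-- The bracket on `𝔤*` induced by `r ∈ ⋀² 𝔤`:
`[ξ, η]_r = L_{r^♯ ξ} η - L_{r^♯ η} ξ`, where `L_x η = - η ∘ ad x` is the coadjoint action. -/
def dualBracket (r : ⋀[ℂ]^2 𝔤) (ξ η : Dual ℂ 𝔤) : Dual ℂ 𝔤 :=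
  -(η ∘ₗ ad ℂ 𝔤 (sharp r ξ)) + ξ ∘ₗ ad ℂ 𝔤 (sharp r η)

/-- `[Ω¹², Ω²³] ∈ 𝔤 ⊗ 𝔤 ⊗ 𝔤` for the Casimir element `Ω = ∑ x_i ⊗ xⁱ` of the Killing form,
where `(x_i)` and `(xⁱ)` are dual bases: it equals `∑_{i,j} x_i ⊗ [xⁱ, x_j] ⊗ xʲ`. -/
def casimirBracket (𝔤 : Type*) [LieRing 𝔤] [LieAlgebra ℂ 𝔤] [Module.Finite ℂ 𝔤]
    [IsKilling ℂ 𝔤] : ⨂[ℂ]^3 𝔤 :=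
  let x := finBasis ℂ 𝔤
  let x' := LinearMap.BilinForm.dualBasis (killingForm ℂ 𝔤)
    (IsKilling.killingForm_nondegenerate ℂ 𝔤) x
  ∑ i, ∑ j, PiTensorProduct.tprod ℂ ![x i, ⁅x' i, x j⁆, x' j]

end LieAlg

variable {𝔤 : Type*} [LieRing 𝔤] [LieAlgebra ℂ 𝔤] [Module.Finite ℂ 𝔤] [IsKilling ℂ 𝔤]
  {H : LieSubalgebra ℂ 𝔤} [H.IsCartanSubalgebra]

/-! ### Root vectors, the standard `r`-matrix, coordinates on `𝔥*` -/

/-- A choice of root vectors `E_α ∈ 𝔤_α`, one for each root `α`, with `⟨E_α, E_{-α}⟩ = 1` for the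
Killing form. (The value at the zero weight plays no role.) -/
structure RootVectors (H : LieSubalgebra ℂ 𝔤) [H.IsCartanSubalgebra] where
  /-- The vector `E_α`. -/
  E : Weight ℂ H 𝔤 → 𝔤
  mem_rootSpace : ∀ α : Weight ℂ H 𝔤, α.IsNonZero → E α ∈ rootSpace H α
  killing_eq_one : ∀ α : Weight ℂ H 𝔤, α.IsNonZero → killingForm ℂ 𝔤 (E α) (E (-α)) = 1

open scoped Classical in
/-- The standard `r`-matrix `r₀ = ∑_{α > 0} E_α ∧ E_{-α}`, positivity being relative to the base
`b` of the root system. -/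
def standardR (b : (rootSystem H).Base) (E : RootVectors H) : ⋀[ℂ]^2 𝔤 :=
  ∑ α : H.root, if b.IsPos α then wedge2 (E.E α.1) (E.E (-α.1)) else 0

/-- The basis `(h_i)` of `𝔥`: `h_i` corresponds to the simple root `α_i` under the Killing form;
equivalently `h_i = [E_{α_i}, E_{-α_i}]`, see `simpleH_eq`. -/
def simpleH (b : (rootSystem H).Base) : Basis b.support ℂ H :=
  b.toWeightBasis.map (cartanEquivDual H).symm

theorem simpleH_eq (b : (rootSystem H).Base) (E : RootVectors H) (i : b.support) :
    ((simpleH b i : H) : 𝔤) = ⁅E.E i.1.1, E.E (-i.1.1)⁆ := by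
  have hi : (i.1.1 : Weight ℂ H 𝔤).IsNonZero := H.isNonZero_coe_root i.1
  have h := lie_eq_killingForm_smul_of_mem_rootSpace_of_mem_rootSpace_neg
    (E.mem_rootSpace _ hi) (by simpa using E.mem_rootSpace _ hi.neg)
  rw [h, E.killing_eq_one _ hi, one_smul]
  simp [simpleH]

open scoped Classical in
/-- The basis `(h_i^*)` of `𝔥*` dual to `(h_i)`; as constant vector fields on `𝔥*`,
`h_i^* = ∂/∂λ_i`. -/
def simpleHDual (b : (rootSystem H).Base) : Basis b.support ℂ (Dual ℂ H) :=
  (simpleH b).dualBasis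

/-- The linear coordinates `λ ↦ (λ_i)` on `𝔥*`, where `λ = ∑ λ_i h_i^*`. -/
def coords (b : (rootSystem H).Base) : Dual ℂ H ≃ₗ[ℂ] (b.support → ℂ) :=
  (simpleHDual b).equivFun

/-- `U ⊆ 𝔥*` is open, in the coordinates `(λ_i)`. -/
def IsOpenInDual (b : (rootSystem H).Base) (U : Set (Dual ℂ H)) : Prop :=
  IsOpen ((coords b).symm ⁻¹' U)

/-- `f` is holomorphic on `U ⊆ 𝔥*` with values in the finite-dimensional complex space `W`: every
linear functional of `f` is a holomorphic function of the coordinates `(λ_i)`. -/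
def HolomorphicOn (b : (rootSystem H).Base) {W : Type*} [AddCommGroup W] [Module ℂ W]
    (f : Dual ℂ H → W) (U : Set (Dual ℂ H)) : Prop :=
  ∀ φ : Dual ℂ W, DifferentiableOn ℂ (fun z => φ (f ((coords b).symm z))) ((coords b).symm ⁻¹' U)

/-- The directional derivative at `x ∈ 𝔥*` in the direction `v ∈ 𝔥*` of a function with values in a
finite-dimensional complex space `W`, computed componentwise in a basis of `W`. -/
def dirDeriv {W : Type*} [AddCommGroup W] [Module ℂ W] [Module.Finite ℂ W]
    (f : Dual ℂ H → W) (x v : Dual ℂ H) : W :=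
  ∑ j, lineDeriv ℂ (fun y => (finBasis ℂ W).repr (f y) j) x v • finBasis ℂ W j

/-! ### Dynamical `r`-matrices -/

/-- `Alt(dr) = ∑ h_i ∧ ∂r/∂λ_i`. -/
def altD (b : (rootSystem H).Base) (r : Dual ℂ H → ⋀[ℂ]^2 𝔤) (x : Dual ℂ H) : ⋀[ℂ]^3 𝔤 :=
  ∑ i, wedge12 (simpleH b i : 𝔤) (dirDeriv r x (simpleHDual b i))

/-- `r : U → ⋀² 𝔤` is a dynamical `r`-matrix with coupling constant `ε`: a holomorphic function of
zero weight that satisfies the modified classical dynamical Yang-Baxter equation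
`Alt(dr) + ½ [r, r] = (ε² / 4) [Ω¹², Ω²³]` in `𝔤 ⊗ 𝔤 ⊗ 𝔤`. Here `⋀³ 𝔤` is embedded in
`𝔤 ⊗ 𝔤 ⊗ 𝔤` by `x₁ ∧ x₂ ∧ x₃ ↦ ∑_σ sgn(σ) x_{σ1} ⊗ x_{σ2} ⊗ x_{σ3}`. -/
structure IsDynamicalRMatrix (b : (rootSystem H).Base) (ε : ℂ) (U : Set (Dual ℂ H))
    (r : Dual ℂ H → ⋀[ℂ]^2 𝔤) : Prop where
  holomorphic : HolomorphicOn b r U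
  zero_weight : ∀ x ∈ U, ∀ h : H, adBivector (h : 𝔤) (r x) = 0
  cdybe : ∀ x ∈ U,
    exteriorPower.toTensorPower ℂ 𝔤 3 (altD b r x + (1 / 2 : ℂ) • schoutenLie (r x) (r x)) =
      (ε ^ 2 / 4) • casimirBracket 𝔤

/-! ### The gauge Lie algebroid `A = TU × 𝔤 ≅ U × (𝔥* ⊕ 𝔤)` and Hamiltonian operators -/

/-- The fibre `𝔥* ⊕ 𝔤` of `A`. A section of `⋀ᵏ A` over `U` is a function on `U` with values in
`⋀ᵏ (𝔥* ⊕ 𝔤)`. -/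
abbrev Fibre (H : LieSubalgebra ℂ 𝔤) : Type _ := Dual ℂ H × 𝔤

/-- The Lie bracket of sections of `A`,
`[X + ξ, Y + η] = [X, Y] + [ξ, η] + L_X η - L_Y ξ`. -/
def gaugeBracket (s t : Dual ℂ H → Fibre H) (x : Dual ℂ H) : Fibre H :=
  (dirDeriv (fun y => (t y).1) x (s x).1 - dirDeriv (fun y => (s y).1) x (t x).1,
    ⁅(s x).2, (t x).2⁆ +
      dirDeriv (fun y => (t y).2) x (s x).1 - dirDeriv (fun y => (s y).2) x (t x).1)

/-- The Schouten bracket of decomposable sections,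
`[X ∧ Y, Z ∧ W] = [X, Z] ∧ Y ∧ W - [X, W] ∧ Y ∧ Z - [Y, Z] ∧ X ∧ W + [Y, W] ∧ X ∧ Z`. -/
def schoutenDecomp (X Y Z W : Dual ℂ H → Fibre H) (x : Dual ℂ H) : ⋀[ℂ]^3 (Fibre H) :=
  wedge3 (gaugeBracket X Z x) (Y x) (W x) - wedge3 (gaugeBracket X W x) (Y x) (Z x)
    - wedge3 (gaugeBracket Y Z x) (X x) (W x) + wedge3 (gaugeBracket Y W x) (X x) (Z x)

/-- The Schouten bracket `Γ(⋀² A) × Γ(⋀² A) → Γ(⋀³ A)`: expand both sections in a global frame of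
constant sections, `P = ½ ∑ (P^{ab} e_a) ∧ e_b`, and use biadditivity. -/
def schouten (P Q : Dual ℂ H → ⋀[ℂ]^2 (Fibre H)) (x : Dual ℂ H) : ⋀[ℂ]^3 (Fibre H) :=
  let e := finBasis ℂ (Fibre H)
  (1 / 4 : ℂ) • ∑ a, ∑ b, ∑ c, ∑ d,
    schoutenDecomp (fun y => coeff2 (P y) a b • e a) (fun _ => e b)
      (fun y => coeff2 (Q y) c d • e c) (fun _ => e d) x

/-- The fibrewise bracket of `A* = T*U × 𝔤*`, the product of the trivial Lie algebroid `T*U` (zero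
bracket and anchor) and the Lie algebra `𝔤*` with the bracket induced by `r`. Its anchor is zero. -/
def dualAlgebroidBracket (r : ⋀[ℂ]^2 𝔤) (ξ η : Dual ℂ (Fibre H)) : Dual ℂ (Fibre H) :=
  dualBracket r (ξ ∘ₗ LinearMap.inr ℂ (Dual ℂ H) 𝔤) (η ∘ₗ LinearMap.inr ℂ (Dual ℂ H) 𝔤) ∘ₗ
    LinearMap.snd ℂ (Dual ℂ H) 𝔤

/-- The differential `d_* : Γ(⋀² A) → Γ(⋀³ A)` of the Lie algebroid `A*`. Since the anchor of `A*`
vanishes, it acts fibrewise by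
`(d_* P)(ξ, η, ζ) = - P([ξ, η], ζ) + P([ξ, ζ], η) - P([η, ζ], ξ)`,
and `T = ⅙ ∑ T(eᵃ, eᵇ, eᶜ) e_a ∧ e_b ∧ e_c` recovers a trivector from its values. -/
def dStar (r : ⋀[ℂ]^2 𝔤) (P : ⋀[ℂ]^2 (Fibre H)) : ⋀[ℂ]^3 (Fibre H) :=
  let e := finBasis ℂ (Fibre H)
  (1 / 6 : ℂ) • ∑ a, ∑ b, ∑ c,
    (- ev2 P (dualAlgebroidBracket r (e.coord a) (e.coord b)) (e.coord c)
      + ev2 P (dualAlgebroidBracket r (e.coord a) (e.coord c)) (e.coord b)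
      - ev2 P (dualAlgebroidBracket r (e.coord b) (e.coord c)) (e.coord a)) •
        wedge3 (e a) (e b) (e c)

/-- The section `P` of `⋀² A` over `U` is a Hamiltonian operator of the coboundary Lie bialgebroid
`(A, A*, r)`: `d_* P + ½ [P, P] = 0`. -/
def IsHamiltonianOperator (r : ⋀[ℂ]^2 𝔤) (U : Set (Dual ℂ H))
    (P : Dual ℂ H → ⋀[ℂ]^2 (Fibre H)) : Prop :=
  ∀ x ∈ U, dStar r (P x) + (1 / 2 : ℂ) • schouten P P x = 0

/-- The constant section `θ = ∑ h_i ∧ ∂/∂λ_i` of `⋀² A`. -/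
def theta (b : (rootSystem H).Base) : ⋀[ℂ]^2 (Fibre H) :=
  ∑ i, wedge2 ((0, (simpleH b i : 𝔤)) : Fibre H) ((simpleHDual b i, 0) : Fibre H)

/-- The inclusion `⋀² 𝔤 → ⋀² (𝔥* ⊕ 𝔤)`, through which a `⋀² 𝔤`-valued function is a section of
`⋀² A`. -/
def inclBivector (H : LieSubalgebra ℂ 𝔤) : ⋀[ℂ]^2 𝔤 →ₗ[ℂ] ⋀[ℂ]^2 (Fibre H) :=
  exteriorPower.map 2 (LinearMap.inr ℂ (Dual ℂ H) 𝔤)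

end DynR

end

/-! Let `B` be the bracket `(0, [x, y])` of constant sections `(v, x)`, `(w, y)` of the gauge
algebroid. The differential `d_*` is the Schouten bracket `[r₀, ·]` for `B`
(`dStar_eq_schoutenWith`), so the Hamiltonian condition for `θ + τ` expands into `[r₀, θ] + [r₀, τ]
+ ½[θ, θ] + [θ, τ] + ½[τ, τ] = 0`.

Here `[θ, θ] = 0` since `𝔥` is abelian, and `[r₀, θ] = 0` since `r₀` has weight zero. The mixed term
is `[θ, τ] = Alt(dτ) - ∑ ∂/∂λ_i ∧ [h_i, τ]`: the vector field in `θ` differentiates `τ`, while `h_i`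
acts on it (`schouten_self`, `anchorPart_theta`, `schoutenWith_theta_inclBivector`). The sum over
`i` lies in `𝔥* ⊗ ⋀² 𝔤` and everything else in `⋀³ 𝔤`, so the condition splits into `[h_i, τ] = 0`
for all `i` and `Alt(dτ) + [r₀, τ] + ½[τ, τ] = 0` (`hamiltonian_expression_eq`,
`map_add_sum_wedge12_eq_zero_iff`).

The second equation is the dynamical Yang-Baxter equation for `r₀ + τ`, because `½[r₀, r₀] = [Ω¹²,
Ω²³]` (`toTensorPower_schoutenLie_standardR`). Under the Killing form `r₀^♯` acts on the root space
of `β` by minus the sign of `β`, and the identity becomes one about the signs of three weights with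
sum zero (`weightSign_identity`). -/

noncomputable section

namespace DynR

open scoped TensorProduct
open LieAlgebra LieAlgebra.IsKilling LieModule Module

/-! ### Bivectors, trivectors and their values on covectors -/

section Multilinear

variable {V W : Type*} [AddCommGroup V] [Module ℂ V] [AddCommGroup W] [Module ℂ W]

/-- The value of a trivector on three covectors. -/
def ev3 (T : ⋀[ℂ]^3 V) (ξ η ζ : Dual ℂ V) : ℂ :=
  exteriorPower.pairingDual ℂ V 3 (exteriorPower.ιMulti ℂ 3 ![ξ, η, ζ]) T

theorem ev3_wedge3 (u v w : V) (ξ η ζ : Dual ℂ V) :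
    ev3 (wedge3 u v w) ξ η ζ =
      ξ u * (η v * ζ w - η w * ζ v) - ξ v * (η u * ζ w - η w * ζ u)
        + ξ w * (η u * ζ v - η v * ζ u) := by
  simp [ev3, wedge3, Matrix.det_fin_three]
  ring

@[simp] theorem ev3_add (S T : ⋀[ℂ]^3 V) (ξ η ζ : Dual ℂ V) :
    ev3 (S + T) ξ η ζ = ev3 S ξ η ζ + ev3 T ξ η ζ := map_add _ _ _

@[simp] theorem ev3_sub (S T : ⋀[ℂ]^3 V) (ξ η ζ : Dual ℂ V) :
    ev3 (S - T) ξ η ζ = ev3 S ξ η ζ - ev3 T ξ η ζ := map_sub _ _ _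

@[simp] theorem ev3_neg (S : ⋀[ℂ]^3 V) (ξ η ζ : Dual ℂ V) :
    ev3 (-S) ξ η ζ = -ev3 S ξ η ζ := map_neg _ _

@[simp] theorem ev3_zero (ξ η ζ : Dual ℂ V) : ev3 (0 : ⋀[ℂ]^3 V) ξ η ζ = 0 := map_zero _

@[simp] theorem ev3_smul (c : ℂ) (S : ⋀[ℂ]^3 V) (ξ η ζ : Dual ℂ V) :
    ev3 (c • S) ξ η ζ = c * ev3 S ξ η ζ := map_smul _ _ _

@[simp] theorem ev3_sum {ι : Type*} (s : Finset ι) (S : ι → ⋀[ℂ]^3 V) (ξ η ζ : Dual ℂ V) :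
    ev3 (∑ i ∈ s, S i) ξ η ζ = ∑ i ∈ s, ev3 (S i) ξ η ζ := map_sum _ _ _

@[simp] theorem ev2_add (S T : ⋀[ℂ]^2 V) (ξ η : Dual ℂ V) :
    ev2 (S + T) ξ η = ev2 S ξ η + ev2 T ξ η := map_add _ _ _

@[simp] theorem ev2_smul (c : ℂ) (S : ⋀[ℂ]^2 V) (ξ η : Dual ℂ V) :
    ev2 (c • S) ξ η = c * ev2 S ξ η := map_smul _ _ _

@[simp] theorem ev2_zero (ξ η : Dual ℂ V) : ev2 (0 : ⋀[ℂ]^2 V) ξ η = 0 := map_zero _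

/-- Decomposables span. No separate case for zero is needed, as it is a scalar multiple of a
decomposable. -/
theorem bivector_induction {p : ⋀[ℂ]^2 V → Prop} (wedge : ∀ u v, p (wedge2 u v))
    (add : ∀ P Q, p P → p Q → p (P + Q)) (smul : ∀ (c : ℂ) P, p P → p (c • P)) (P) : p P := by
  have hP : P ∈ Submodule.span ℂ (Set.range (exteriorPower.ιMulti ℂ 2 (M := V))) := by
    rw [exteriorPower.ιMulti_span]; trivial
  induction hP using Submodule.span_induction with
  | mem x hx =>
    obtain ⟨v, rfl⟩ := hx
    have : v = ![v 0, v 1] := by ext i; fin_cases i <;> rfl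
    rw [this]
    exact wedge _ _
  | zero => simpa using smul 0 _ (wedge 0 0)
  | add x y _ _ hx hy => exact add _ _ hx hy
  | smul c x _ hx => exact smul _ _ hx

theorem trivector_induction {p : ⋀[ℂ]^3 V → Prop} (wedge : ∀ u v w, p (wedge3 u v w))
    (add : ∀ P Q, p P → p Q → p (P + Q)) (smul : ∀ (c : ℂ) P, p P → p (c • P)) (P) : p P := by
  have hP : P ∈ Submodule.span ℂ (Set.range (exteriorPower.ιMulti ℂ 3 (M := V))) := by
    rw [exteriorPower.ιMulti_span]; trivial
  induction hP using Submodule.span_induction with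
  | mem x hx =>
    obtain ⟨v, rfl⟩ := hx
    have : v = ![v 0, v 1, v 2] := by ext i; fin_cases i <;> rfl
    rw [this]
    exact wedge _ _ _
  | zero => simpa using smul 0 _ (wedge 0 0 0)
  | add x y _ _ hx hy => exact add _ _ hx hy
  | smul c x _ hx => exact smul _ _ hx

@[simp] theorem map_wedge2 (f : V →ₗ[ℂ] W) (u v : V) :
    exteriorPower.map 2 f (wedge2 u v) = wedge2 (f u) (f v) := by
  rw [wedge2, exteriorPower.map_apply_ιMulti, wedge2]
  congr 1
  ext i; fin_cases i <;> rfl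

@[simp] theorem map_wedge3 (f : V →ₗ[ℂ] W) (u v w : V) :
    exteriorPower.map 3 f (wedge3 u v w) = wedge3 (f u) (f v) (f w) := by
  rw [wedge3, exteriorPower.map_apply_ιMulti, wedge3]
  congr 1
  ext i; fin_cases i <;> rfl

theorem ev2_map (f : V →ₗ[ℂ] W) (P : ⋀[ℂ]^2 V) (ξ η : Dual ℂ W) :
    ev2 (exteriorPower.map 2 f P) ξ η = ev2 P (ξ ∘ₗ f) (η ∘ₗ f) := by
  induction P using bivector_induction with
  | wedge u v => simp [ev2_wedge2]
  | add P Q hP hQ => simp [hP, hQ]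
  | smul c P hP => simp [hP]

/-- The functional `ξ ⊗ η ⊗ ζ` on `V ⊗ V ⊗ V`. -/
def tensorEval (ξ η ζ : Dual ℂ V) : ⨂[ℂ]^3 V →ₗ[ℂ] ℂ :=
  TensorPower.multilinearMapToDual ℂ V 3 ![ξ, η, ζ]

@[simp] theorem tensorEval_tprod (ξ η ζ : Dual ℂ V) (v : Fin 3 → V) :
    tensorEval ξ η ζ (PiTensorProduct.tprod ℂ v) = ξ (v 0) * η (v 1) * ζ (v 2) := by
  simp [tensorEval, TensorPower.multilinearMapToDual_apply_tprod, Fin.prod_univ_three]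

/-- `exteriorPower.pairingDual` is itself defined through the antisymmetrising embedding, so no
factor `3!` separates the two pairings. -/
theorem tensorEval_toTensorPower (ξ η ζ : Dual ℂ V) (T : ⋀[ℂ]^3 V) :
    tensorEval ξ η ζ (exteriorPower.toTensorPower ℂ V 3 T) = ev3 T ξ η ζ := by
  rw [ev3, exteriorPower.pairingDual, exteriorPower.alternatingMapLinearEquiv_apply_ιMulti]
  rfl

theorem tensor_eq_sum {ι : Type*} [Fintype ι] (e : Basis ι ℂ V) (t : ⨂[ℂ]^3 V) :
    t = ∑ a, ∑ b, ∑ c, tensorEval (e.coord a) (e.coord b) (e.coord c) t •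
      PiTensorProduct.tprod ℂ ![e a, e b, e c] := by
  classical
  let F : ⨂[ℂ]^3 V →ₗ[ℂ] ⨂[ℂ]^3 V := ∑ a, ∑ b, ∑ c,
    (tensorEval (e.coord a) (e.coord b) (e.coord c)).smulRight
      (PiTensorProduct.tprod ℂ ![e a, e b, e c])
  have hF : F = LinearMap.id := by
    refine (Basis.piTensorProduct (fun _ : Fin 3 => e)).ext fun p => ?_
    have : (fun i => e (p i)) = ![e (p 0), e (p 1), e (p 2)] := by
      ext i; fin_cases i <;> rfl
    simp [F, Basis.piTensorProduct_apply, LinearMap.sum_apply, Finsupp.single_apply,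
      ite_smul, Finset.sum_ite_eq, this]
  have := congrArg (fun G => G t) hF
  simpa [F, LinearMap.sum_apply] using this.symm

theorem tensor_ext {ι : Type*} [Fintype ι] (e : Basis ι ℂ V) {s t : ⨂[ℂ]^3 V}
    (h : ∀ a b c, tensorEval (e.coord a) (e.coord b) (e.coord c) s =
      tensorEval (e.coord a) (e.coord b) (e.coord c) t) : s = t := by
  rw [tensor_eq_sum e s, tensor_eq_sum e t]
  simp only [h]

/-- The projection `u ⊗ v ⊗ w ↦ u ∧ v ∧ w`. -/
def tensorToWedge : ⨂[ℂ]^3 V →ₗ[ℂ] ⋀[ℂ]^3 V :=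
  PiTensorProduct.lift (exteriorPower.ιMulti ℂ 3).toMultilinearMap

/-- The sign of `σ` in the embedding cancels the sign from permuting the wedge factors, so all `3! =
6` terms agree. Both the expansion of a trivector in a basis and the injectivity of the embedding
follow. -/
theorem tensorToWedge_toTensorPower (T : ⋀[ℂ]^3 V) :
    tensorToWedge (exteriorPower.toTensorPower ℂ V 3 T) = (6 : ℂ) • T := by
  induction T using trivector_induction with
  | wedge u v w =>
    rw [wedge3, exteriorPower.toTensorPower_apply_ιMulti, map_sum]
    have : ∀ σ : Equiv.Perm (Fin 3), tensorToWedge (Equiv.Perm.sign σ •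
        PiTensorProduct.tprod ℂ (fun i => ![u, v, w] (σ i))) =
        exteriorPower.ιMulti ℂ 3 ![u, v, w] := by
      intro σ
      rw [Units.smul_def, map_zsmul, tensorToWedge, PiTensorProduct.lift.tprod]
      have h := (exteriorPower.ιMulti ℂ 3 (M := V)).map_perm ![u, v, w] σ
      simp only [Function.comp_def] at h
      rw [AlternatingMap.coe_multilinearMap, h, Units.smul_def, smul_smul]
      simp [← Units.val_mul]
    rw [Finset.sum_congr rfl fun σ _ => this σ, Finset.sum_const, Finset.card_univ,
      Fintype.card_perm, Fintype.card_fin, ← Nat.cast_smul_eq_nsmul ℂ]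
    norm_num [Nat.factorial]
  | add P Q hP hQ => simp [hP, hQ]
  | smul c P hP => rw [map_smul, map_smul, hP, smul_comm]

theorem trivector_eq_sum {ι : Type*} [Fintype ι] (e : Basis ι ℂ V) (T : ⋀[ℂ]^3 V) :
    T = (1 / 6 : ℂ) • ∑ a, ∑ b, ∑ c, ev3 T (e.coord a) (e.coord b) (e.coord c) •
      wedge3 (e a) (e b) (e c) := by
  have h := congrArg tensorToWedge (tensor_eq_sum e (exteriorPower.toTensorPower ℂ V 3 T))
  rw [tensorToWedge_toTensorPower] at h
  simp only [map_sum, map_smul, tensorEval_toTensorPower] at h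
  have h3 : ∀ u v w : V, tensorToWedge (PiTensorProduct.tprod ℂ ![u, v, w]) = wedge3 u v w :=
    fun u v w => by rw [tensorToWedge, PiTensorProduct.lift.tprod]; rfl
  simp only [h3] at h
  rw [← h, smul_smul]
  norm_num

variable [Module.Finite ℂ V]

/-- This turns identities between trivectors into polynomial identities between scalars, which
`ring` decides. -/
theorem trivector_ext {S T : ⋀[ℂ]^3 V} (h : ∀ ξ η ζ, ev3 S ξ η ζ = ev3 T ξ η ζ) : S = T := by
  rw [trivector_eq_sum (finBasis ℂ V) S, trivector_eq_sum (finBasis ℂ V) T]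
  simp only [h]

omit [Module.Finite ℂ V] in
theorem toTensorPower_injective :
    Function.Injective (exteriorPower.toTensorPower ℂ V 3) := fun S T h => by
  have := congrArg tensorToWedge h
  rw [tensorToWedge_toTensorPower, tensorToWedge_toTensorPower] at this
  exact smul_right_injective _ (by norm_num) this

theorem wedge3_add_left (u u' v w : V) : wedge3 (u + u') v w = wedge3 u v w + wedge3 u' v w :=
  trivector_ext fun _ _ _ => by simp only [ev3_wedge3, ev3_add, map_add]; ring

theorem wedge3_smul_left (c : ℂ) (u v w : V) : wedge3 (c • u) v w = c • wedge3 u v w :=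
  trivector_ext fun _ _ _ => by simp only [ev3_wedge3, ev3_smul, map_smul, smul_eq_mul]; ring

theorem wedge3_add_mid (u v v' w : V) : wedge3 u (v + v') w = wedge3 u v w + wedge3 u v' w :=
  trivector_ext fun _ _ _ => by simp only [ev3_wedge3, ev3_add, map_add]; ring

theorem wedge3_smul_mid (c : ℂ) (u v w : V) : wedge3 u (c • v) w = c • wedge3 u v w :=
  trivector_ext fun _ _ _ => by simp only [ev3_wedge3, ev3_smul, map_smul, smul_eq_mul]; ring

theorem wedge3_add_right (u v w w' : V) : wedge3 u v (w + w') = wedge3 u v w + wedge3 u v w' :=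
  trivector_ext fun _ _ _ => by simp only [ev3_wedge3, ev3_add, map_add]; ring

theorem wedge3_smul_right (c : ℂ) (u v w : V) : wedge3 u v (c • w) = c • wedge3 u v w :=
  trivector_ext fun _ _ _ => by simp only [ev3_wedge3, ev3_smul, map_smul, smul_eq_mul]; ring

@[simp] theorem wedge3_zero_left (v w : V) : wedge3 0 v w = 0 :=
  trivector_ext fun _ _ _ => by simp [ev3_wedge3]

/-! ### The linear extension of an alternating bilinear map to bivectors -/

theorem coeff2_add (P Q : ⋀[ℂ]^2 V) (a b) : coeff2 (P + Q) a b = coeff2 P a b + coeff2 Q a b :=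
  ev2_add _ _ _ _

theorem coeff2_smul (c : ℂ) (P : ⋀[ℂ]^2 V) (a b) : coeff2 (c • P) a b = c * coeff2 P a b :=
  ev2_smul _ _ _ _

@[simp] theorem extend2_add (f : V → V → W) (P Q : ⋀[ℂ]^2 V) :
    extend2 f (P + Q) = extend2 f P + extend2 f Q := by
  simp [extend2, coeff2_add, add_smul, Finset.sum_add_distrib]

@[simp] theorem extend2_smul (f : V → V → W) (c : ℂ) (P : ⋀[ℂ]^2 V) :
    extend2 f (c • P) = c • extend2 f P := by
  simp only [extend2, coeff2_smul, mul_smul, Finset.smul_sum]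
  simp only [smul_comm c (1 / 2 : ℂ)]

@[simp] theorem extend2_zero (f : V → V → W) : extend2 f (0 : ⋀[ℂ]^2 V) = 0 := by
  simpa using extend2_smul f 0 0

/-- The linear map `extend2 f`. -/
def extend2L (f : V → V → W) : ⋀[ℂ]^2 V →ₗ[ℂ] W where
  toFun := extend2 f
  map_add' := extend2_add f
  map_smul' := extend2_smul f

theorem extend2_sum {ι : Type*} (s : Finset ι) (f : V → V → W) (P : ι → ⋀[ℂ]^2 V) :
    extend2 f (∑ i ∈ s, P i) = ∑ i ∈ s, extend2 f (P i) := map_sum (extend2L f) _ _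

theorem extend2_wedge2_of_alternating {f : V → V → W}
    (add_left : ∀ x x' y, f (x + x') y = f x y + f x' y)
    (smul_left : ∀ (c : ℂ) x y, f (c • x) y = c • f x y)
    (add_right : ∀ x y y', f x (y + y') = f x y + f x y')
    (smul_right : ∀ (c : ℂ) x y, f x (c • y) = c • f x y)
    (alt : ∀ x, f x x = 0) (u v : V) : extend2 f (wedge2 u v) = f u v :=
  extend2_wedge2 (LinearMap.mk₂ ℂ f add_left smul_left add_right smul_right) alt u v

omit [Module.Finite ℂ V] in
theorem wedge2_add_left (u u' v : V) : wedge2 (u + u') v = wedge2 u v + wedge2 u' v :=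
  (exteriorPower.ιMulti ℂ 2 (M := V)).toMultilinearMap.cons_add ![v] u u'

omit [Module.Finite ℂ V] in
theorem wedge2_smul_left (c : ℂ) (u v : V) : wedge2 (c • u) v = c • wedge2 u v :=
  (exteriorPower.ιMulti ℂ 2 (M := V)).toMultilinearMap.cons_smul ![v] c u

omit [Module.Finite ℂ V] in
@[simp] theorem wedge2_self (u : V) : wedge2 u u = 0 :=
  (exteriorPower.ιMulti ℂ 2 (M := V)).map_eq_zero_of_eq ![u, u] (i := 0) (j := 1) rfl (by simp)

omit [Module.Finite ℂ V] in
theorem wedge2_swap (u v : V) : wedge2 u v = -wedge2 v u := by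
  have h := (exteriorPower.ιMulti ℂ 2 (M := V)).map_swap ![v, u] (i := 0) (j := 1) (by simp)
  rw [wedge2, wedge2, ← h]
  congr 1
  ext i; fin_cases i <;> simp

omit [Module.Finite ℂ V] in
theorem wedge2_add_right (u v v' : V) : wedge2 u (v + v') = wedge2 u v + wedge2 u v' := by
  rw [wedge2_swap, wedge2_add_left, neg_add, ← wedge2_swap, ← wedge2_swap]

omit [Module.Finite ℂ V] in
theorem wedge2_smul_right (c : ℂ) (u v : V) : wedge2 u (c • v) = c • wedge2 u v := by
  rw [wedge2_swap, wedge2_smul_left, wedge2_swap u v, smul_neg]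

theorem extend2_wedge2_self (P : ⋀[ℂ]^2 V) : extend2 wedge2 P = P := by
  induction P using bivector_induction with
  | wedge u v =>
    exact extend2_wedge2_of_alternating wedge2_add_left wedge2_smul_left wedge2_add_right
      wedge2_smul_right wedge2_self u v
  | add P Q hP hQ => simp [hP, hQ]
  | smul c P hP => simp [hP]

theorem bivector_ext {P Q : ⋀[ℂ]^2 V} (h : ∀ ξ η, ev2 P ξ η = ev2 Q ξ η) : P = Q := by
  rw [← extend2_wedge2_self P, ← extend2_wedge2_self Q]
  simp only [extend2, coeff2, h]

@[simp] theorem wedge12_wedge2 (u v w : V) : wedge12 u (wedge2 v w) = wedge3 u v w :=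
  extend2_wedge2_of_alternating (f := fun a b => wedge3 u a b) (fun _ _ _ => wedge3_add_mid _ _ _ _)
    (fun _ _ _ => wedge3_smul_mid _ _ _ _) (fun _ _ _ => wedge3_add_right _ _ _ _)
    (fun _ _ _ => wedge3_smul_right _ _ _ _)
    (fun x => trivector_ext fun _ _ _ => by simp only [ev3_wedge3, ev3_zero]; ring) v w

@[simp] theorem wedge12_add (u : V) (P Q : ⋀[ℂ]^2 V) :
    wedge12 u (P + Q) = wedge12 u P + wedge12 u Q := extend2_add _ _ _

@[simp] theorem wedge12_smul (u : V) (c : ℂ) (P : ⋀[ℂ]^2 V) :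
    wedge12 u (c • P) = c • wedge12 u P := extend2_smul _ _ _

@[simp] theorem wedge12_zero (u : V) : wedge12 u 0 = 0 := map_zero (extend2L _)

theorem wedge12_add_left (u u' : V) (P : ⋀[ℂ]^2 V) :
    wedge12 (u + u') P = wedge12 u P + wedge12 u' P := by
  simp [wedge12, extend2, wedge3_add_left, Finset.sum_add_distrib]

theorem wedge12_smul_left (c : ℂ) (u : V) (P : ⋀[ℂ]^2 V) :
    wedge12 (c • u) P = c • wedge12 u P := by
  induction P using bivector_induction with
  | wedge v w => simp [wedge3_smul_left]
  | add P Q hP hQ => simp [hP, hQ]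
  | smul d P hP => rw [wedge12_smul, wedge12_smul, hP, smul_comm]

theorem map_wedge12 [Module.Finite ℂ W] (f : V →ₗ[ℂ] W) (u : V) (P : ⋀[ℂ]^2 V) :
    exteriorPower.map 3 f (wedge12 u P) = wedge12 (f u) (exteriorPower.map 2 f P) := by
  induction P using bivector_induction with
  | wedge v w => simp
  | add P Q hP hQ => simp [hP, hQ]
  | smul c P hP => simp [hP]

theorem ev3_wedge12 (u : V) (P : ⋀[ℂ]^2 V) (ξ η ζ : Dual ℂ V) :
    ev3 (wedge12 u P) ξ η ζ = ξ u * ev2 P η ζ - η u * ev2 P ξ ζ + ζ u * ev2 P ξ η := by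
  induction P using bivector_induction with
  | wedge v w => simp only [wedge12_wedge2, ev3_wedge3, ev2_wedge2]; ring
  | add P Q hP hQ => simp only [wedge12_add, ev3_add, ev2_add, hP, hQ]; ring
  | smul c P hP => simp only [wedge12_smul, ev3_smul, ev2_smul, hP]; ring

theorem sharp_wedge2 (u v : V) (ξ : Dual ℂ V) : sharp (wedge2 u v) ξ = ξ u • v - ξ v • u :=
  extend2_wedge2_of_alternating (f := fun a b => ξ a • b - ξ b • a)
    (fun _ _ _ => by simp only [map_add, add_smul, smul_add]; abel)
    (fun _ _ _ => by simp only [map_smul, smul_eq_mul, mul_smul, smul_sub]; rw [smul_comm (ξ _)])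
    (fun _ _ _ => by simp only [map_add, add_smul, smul_add]; abel)
    (fun _ _ _ => by simp only [map_smul, smul_eq_mul, mul_smul, smul_sub]; rw [smul_comm (ξ _)])
    (fun _ => sub_self _) u v

@[simp] theorem sharp_add (P Q : ⋀[ℂ]^2 V) (ξ : Dual ℂ V) :
    sharp (P + Q) ξ = sharp P ξ + sharp Q ξ := extend2_add _ _ _

@[simp] theorem sharp_smul (c : ℂ) (P : ⋀[ℂ]^2 V) (ξ : Dual ℂ V) :
    sharp (c • P) ξ = c • sharp P ξ := extend2_smul _ _ _

theorem sharp_sum {ι : Type*} (s : Finset ι) (P : ι → ⋀[ℂ]^2 V) (ξ : Dual ℂ V) :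
    sharp (∑ i ∈ s, P i) ξ = ∑ i ∈ s, sharp (P i) ξ := extend2_sum _ _ _

end Multilinear

/-! ### The Schouten bracket of bivectors for an arbitrary bilinear bracket -/

section Schouten

variable {V W : Type*} [AddCommGroup V] [Module ℂ V] [Module.Finite ℂ V]
  [AddCommGroup W] [Module ℂ W] [Module.Finite ℂ W]

omit [Module.Finite ℂ W] in
theorem extend2_fun_add (f g : V → V → W) (P : ⋀[ℂ]^2 V) :
    extend2 (fun a b => f a b + g a b) P = extend2 f P + extend2 g P := by
  simp [extend2, Finset.sum_add_distrib]

omit [Module.Finite ℂ W] in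
theorem extend2_fun_smul (c : ℂ) (f : V → V → W) (P : ⋀[ℂ]^2 V) :
    extend2 (fun a b => c • f a b) P = c • extend2 f P := by
  simp only [extend2, smul_comm _ c, Finset.smul_sum]

/-- The Schouten bracket of `a ∧ b` and `c ∧ d` for the bracket `B`. -/
def schoutenDecompWith (B : V →ₗ[ℂ] V →ₗ[ℂ] V) (a b c d : V) : ⋀[ℂ]^3 V :=
  wedge3 (B a c) b d - wedge3 (B a d) b c - wedge3 (B b c) a d + wedge3 (B b d) a c

omit [Module.Finite ℂ V] in
theorem ev3_schoutenDecompWith (B : V →ₗ[ℂ] V →ₗ[ℂ] V) (a b c d : V) (ξ η ζ : Dual ℂ V) :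
    ev3 (schoutenDecompWith B a b c d) ξ η ζ =
      ev3 (wedge3 (B a c) b d) ξ η ζ - ev3 (wedge3 (B a d) b c) ξ η ζ
        - ev3 (wedge3 (B b c) a d) ξ η ζ + ev3 (wedge3 (B b d) a c) ξ η ζ := by
  simp [schoutenDecompWith]

theorem extend2_schoutenDecompWith (B : V →ₗ[ℂ] V →ₗ[ℂ] V) (a b c d : V) :
    extend2 (schoutenDecompWith B a b) (wedge2 c d) = schoutenDecompWith B a b c d := by
  apply extend2_wedge2_of_alternating <;> intros <;> refine trivector_ext fun _ _ _ => ?_ <;>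
    simp only [ev3_schoutenDecompWith, ev3_wedge3, ev3_add, ev3_smul, map_add, map_smul,
      smul_eq_mul, ev3_zero] <;> ring

/-- The Schouten bracket of bivectors for the bilinear bracket `B`. -/
def schoutenWith (B : V →ₗ[ℂ] V →ₗ[ℂ] V) : ⋀[ℂ]^2 V →ₗ[ℂ] ⋀[ℂ]^2 V →ₗ[ℂ] ⋀[ℂ]^3 V :=
  LinearMap.mk₂ ℂ (fun P Q => extend2 (fun a b => extend2 (schoutenDecompWith B a b) Q) P)
    (fun _ _ _ => extend2_add _ _ _) (fun _ _ _ => extend2_smul _ _ _)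
    (fun _ _ _ => by simp only [extend2_add]; exact extend2_fun_add _ _ _)
    (fun _ _ _ => by simp only [extend2_smul]; exact extend2_fun_smul _ _ _)

theorem schoutenWith_apply (B : V →ₗ[ℂ] V →ₗ[ℂ] V) (P Q : ⋀[ℂ]^2 V) :
    schoutenWith B P Q = extend2 (fun a b => extend2 (schoutenDecompWith B a b) Q) P := rfl

@[simp] theorem schoutenWith_wedge2 (B : V →ₗ[ℂ] V →ₗ[ℂ] V) (a b c d : V) :
    schoutenWith B (wedge2 a b) (wedge2 c d) = schoutenDecompWith B a b c d := by
  simp only [schoutenWith_apply, extend2_schoutenDecompWith]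
  apply extend2_wedge2_of_alternating (f := fun a b => schoutenDecompWith B a b c d) <;> intros <;>
    refine trivector_ext fun _ _ _ => ?_ <;>
    simp only [ev3_schoutenDecompWith, ev3_wedge3, ev3_add, ev3_smul, map_add, map_smul,
      LinearMap.add_apply, LinearMap.smul_apply, smul_eq_mul, ev3_zero] <;> ring

omit [Module.Finite ℂ V] [Module.Finite ℂ W] in
theorem bivector_linearMap_ext {F G : ⋀[ℂ]^2 V →ₗ[ℂ] W}
    (h : ∀ u v, F (wedge2 u v) = G (wedge2 u v)) : F = G := by
  refine LinearMap.ext fun P => ?_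
  induction P using bivector_induction with
  | wedge u v => exact h u v
  | add P Q hP hQ => rw [map_add, map_add, hP, hQ]
  | smul c P hP => rw [map_smul, map_smul, hP]

/-- Antisymmetry of `B` is enough; the Jacobi identity plays no role. The symmetry merges the two
cross terms of the bracket of a sum with itself. -/
theorem schoutenWith_comm {B : V →ₗ[ℂ] V →ₗ[ℂ] V} (hB : ∀ x y, B x y = -B y x)
    (P Q : ⋀[ℂ]^2 V) : schoutenWith B P Q = schoutenWith B Q P := by
  suffices h : schoutenWith B = (schoutenWith B).flip from
    congrArg (fun F => F P Q) h
  refine bivector_linearMap_ext fun a b => bivector_linearMap_ext fun c d => ?_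
  rw [LinearMap.flip_apply, schoutenWith_wedge2, schoutenWith_wedge2]
  refine trivector_ext fun _ _ _ => ?_
  simp only [ev3_schoutenDecompWith, ev3_wedge3, hB c a, hB d a, hB c b, hB d b, map_neg]
  ring

theorem map_schoutenWith {B : V →ₗ[ℂ] V →ₗ[ℂ] V} {B' : W →ₗ[ℂ] W →ₗ[ℂ] W} {f : V →ₗ[ℂ] W}
    (hf : ∀ x y, f (B x y) = B' (f x) (f y)) (P Q : ⋀[ℂ]^2 V) :
    exteriorPower.map 3 f (schoutenWith B P Q) =
      schoutenWith B' (exteriorPower.map 2 f P) (exteriorPower.map 2 f Q) := by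
  suffices h : (schoutenWith B).compr₂ (exteriorPower.map 3 f) =
      (schoutenWith B').compl₁₂ (exteriorPower.map 2 f) (exteriorPower.map 2 f) from
    congrArg (fun F => F P Q) h
  refine bivector_linearMap_ext fun a b => bivector_linearMap_ext fun c d => ?_
  simp [schoutenDecompWith, hf]

/-- The value `[P, Q](ξ, η, ζ)` in terms of the maps `P^♯` and `Q^♯`. -/
theorem ev3_schoutenWith {B : V →ₗ[ℂ] V →ₗ[ℂ] V} (hB : ∀ x y, B x y = -B y x)
    (P Q : ⋀[ℂ]^2 V) (ξ η ζ : Dual ℂ V) :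
    ev3 (schoutenWith B P Q) ξ η ζ =
      ξ (B (sharp P η) (sharp Q ζ)) + ξ (B (sharp Q η) (sharp P ζ))
        + η (B (sharp P ζ) (sharp Q ξ)) + η (B (sharp Q ζ) (sharp P ξ))
        + ζ (B (sharp P ξ) (sharp Q η)) + ζ (B (sharp Q ξ) (sharp P η)) := by
  induction P using bivector_induction with
  | wedge a b =>
    induction Q using bivector_induction with
    | wedge c d =>
      simp only [schoutenWith_wedge2, ev3_schoutenDecompWith, ev3_wedge3, sharp_wedge2, map_sub,
        map_smul, LinearMap.sub_apply, LinearMap.smul_apply, smul_eq_mul, hB c a, hB d a, hB c b,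
        hB d b, map_neg]
      ring
    | add P Q hP hQ =>
      simp only [map_add, ev3_add, hP, hQ, sharp_add, LinearMap.add_apply]; ring
    | smul c P hP =>
      simp only [map_smul, ev3_smul, hP, sharp_smul, LinearMap.smul_apply, smul_eq_mul]; ring
  | add P Q hP hQ =>
    simp only [map_add, ev3_add, hP, hQ, sharp_add, LinearMap.add_apply]; ring
  | smul c P hP =>
    simp only [map_smul, ev3_smul, hP, sharp_smul, LinearMap.smul_apply, smul_eq_mul]; ring

end Schouten

/-! ### The Lie algebra and the fibre of the gauge algebroid -/

section LieAlg

variable {𝔤 : Type*} [LieRing 𝔤] [LieAlgebra ℂ 𝔤] [Module.Finite ℂ 𝔤]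

/-- The Lie bracket of `𝔤` as a bilinear map. -/
def lieBilin (𝔤 : Type*) [LieRing 𝔤] [LieAlgebra ℂ 𝔤] : 𝔤 →ₗ[ℂ] 𝔤 →ₗ[ℂ] 𝔤 :=
  LinearMap.mk₂ ℂ (fun x y => ⁅x, y⁆) add_lie smul_lie lie_add (fun c x y => lie_smul c x y)

omit [Module.Finite ℂ 𝔤] in
@[simp] theorem lieBilin_apply (x y : 𝔤) : lieBilin 𝔤 x y = ⁅x, y⁆ := rfl

theorem schoutenLie_eq (P Q : ⋀[ℂ]^2 𝔤) : schoutenLie P Q = schoutenWith (lieBilin 𝔤) P Q := rfl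

@[simp] theorem adBivector_wedge2 (x a b : 𝔤) :
    adBivector x (wedge2 a b) = wedge2 ⁅x, a⁆ b + wedge2 a ⁅x, b⁆ := by
  apply extend2_wedge2_of_alternating (f := fun a b => wedge2 ⁅x, a⁆ b + wedge2 a ⁅x, b⁆)
  · intros; simp only [lie_add, wedge2_add_left]; abel
  · intros; simp only [lie_smul, wedge2_smul_left, smul_add]
  · intros; simp only [lie_add, wedge2_add_right]; abel
  · intros; simp only [lie_smul, wedge2_smul_right, smul_add]
  · intro a; rw [wedge2_swap, neg_add_cancel]

@[simp] theorem adBivector_add (x : 𝔤) (P Q : ⋀[ℂ]^2 𝔤) :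
    adBivector x (P + Q) = adBivector x P + adBivector x Q := extend2_add _ _ _

@[simp] theorem adBivector_smul (x : 𝔤) (c : ℂ) (P : ⋀[ℂ]^2 𝔤) :
    adBivector x (c • P) = c • adBivector x P := extend2_smul _ _ _

@[simp] theorem adBivector_zero (x : 𝔤) : adBivector x (0 : ⋀[ℂ]^2 𝔤) = 0 := extend2_zero _

theorem adBivector_sum {ι : Type*} (s : Finset ι) (x : 𝔤) (P : ι → ⋀[ℂ]^2 𝔤) :
    adBivector x (∑ i ∈ s, P i) = ∑ i ∈ s, adBivector x (P i) := extend2_sum _ _ _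

theorem adBivector_add_left (x y : 𝔤) (P : ⋀[ℂ]^2 𝔤) :
    adBivector (x + y) P = adBivector x P + adBivector y P := by
  rw [adBivector, adBivector, adBivector, ← extend2_fun_add]
  congr 1
  ext1 a; ext1 b
  simp only [add_lie, wedge2_add_left, wedge2_add_right]
  abel

theorem adBivector_smul_left (c : ℂ) (x : 𝔤) (P : ⋀[ℂ]^2 𝔤) :
    adBivector (c • x) P = c • adBivector x P := by
  rw [adBivector, adBivector, ← extend2_fun_smul]
  congr 1
  ext1 a; ext1 b
  simp only [smul_lie, wedge2_smul_left, wedge2_smul_right, smul_add]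

variable {H : LieSubalgebra ℂ 𝔤}

/-- The Lie bracket of constant sections of the gauge algebroid. -/
def fibreBracket (H : LieSubalgebra ℂ 𝔤) : Fibre H →ₗ[ℂ] Fibre H →ₗ[ℂ] Fibre H :=
  ((lieBilin 𝔤).compl₁₂ (LinearMap.snd ℂ (Dual ℂ H) 𝔤) (LinearMap.snd ℂ (Dual ℂ H) 𝔤)).compr₂
    (LinearMap.inr ℂ (Dual ℂ H) 𝔤)

omit [Module.Finite ℂ 𝔤] in
@[simp] theorem fibreBracket_apply (p q : Fibre H) : fibreBracket H p q = (0, ⁅p.2, q.2⁆) := rfl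

omit [Module.Finite ℂ 𝔤] in
theorem fibreBracket_swap (p q : Fibre H) : fibreBracket H p q = -fibreBracket H q p := by
  ext <;> simp

theorem dualAlgebroidBracket_apply (r : ⋀[ℂ]^2 𝔤) (ξ η : Dual ℂ (Fibre H)) (p : Fibre H) :
    dualAlgebroidBracket r ξ η p =
      -η (0, ⁅sharp r (ξ ∘ₗ LinearMap.inr ℂ (Dual ℂ H) 𝔤), p.2⁆) +
        ξ (0, ⁅sharp r (η ∘ₗ LinearMap.inr ℂ (Dual ℂ H) 𝔤), p.2⁆) := rfl

/-- The differential of the dual algebroid is `[r, ·]`. -/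
theorem dStar_eq_schoutenWith (r : ⋀[ℂ]^2 𝔤) (P : ⋀[ℂ]^2 (Fibre H)) :
    dStar r P = schoutenWith (fibreBracket H) (inclBivector H r) P := by
  have key : ∀ ξ η ζ : Dual ℂ (Fibre H),
      - ev2 P (dualAlgebroidBracket r ξ η) ζ + ev2 P (dualAlgebroidBracket r ξ ζ) η
        - ev2 P (dualAlgebroidBracket r η ζ) ξ =
      ev3 (schoutenWith (fibreBracket H) (inclBivector H r) P) ξ η ζ := by
    intro ξ η ζ
    -- These let a covector on the fibre be expanded linearly in the `𝔤`-component of its argument.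
    have hs : ∀ (c : ℂ) (x : 𝔤), ((0, c • x) : Fibre H) = c • ((0, x) : Fibre H) := by simp
    have ha : ∀ (x y : 𝔤), ((0, x + y) : Fibre H) = ((0, x) : Fibre H) + (0, y) := by simp
    have hd : ∀ (x y : 𝔤), ((0, x - y) : Fibre H) = ((0, x) : Fibre H) - (0, y) := by simp
    -- Both sides are linear in `P` and in `r`, so decomposable `P` and `r` suffice.
    induction P using bivector_induction with
    | wedge p q =>
      induction r using bivector_induction with
      | wedge u v =>
        simp only [inclBivector, map_wedge2, schoutenWith_wedge2, ev3_schoutenDecompWith,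
          ev3_wedge3, ev2_wedge2, dualAlgebroidBracket_apply, sharp_wedge2, sub_lie, smul_lie,
          fibreBracket_apply, hs, hd, map_sub, map_smul, smul_eq_mul, LinearMap.comp_apply,
          LinearMap.inr_apply]
        ring
      | add r s hr hs =>
        simp only [ev2_wedge2, dualAlgebroidBracket_apply, map_add, LinearMap.add_apply, ev3_add,
          ← hr, ← hs, sharp_add, add_lie, ha]
        ring
      | smul c r hr =>
        simp only [ev2_wedge2, dualAlgebroidBracket_apply, map_smul, LinearMap.smul_apply,
          ev3_smul, ← hr, sharp_smul, smul_lie, hs, smul_eq_mul]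
        ring
    | add P Q hP hQ => simp only [ev2_add, map_add, ev3_add, ← hP, ← hQ]; ring
    | smul c P hP => simp only [ev2_smul, map_smul, ev3_smul, ← hP]; ring
  rw [trivector_eq_sum (finBasis ℂ (Fibre H))
    (schoutenWith (fibreBracket H) (inclBivector H r) P)]
  simp only [dStar, key]

theorem schoutenWith_inclBivector (P Q : ⋀[ℂ]^2 𝔤) :
    schoutenWith (fibreBracket H) (inclBivector H P) (inclBivector H Q) =
      exteriorPower.map 3 (LinearMap.inr ℂ (Dual ℂ H) 𝔤) (schoutenLie P Q) := by
  have hf : ∀ x y : 𝔤, LinearMap.inr ℂ (Dual ℂ H) 𝔤 (lieBilin 𝔤 x y) =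
      fibreBracket H (LinearMap.inr ℂ (Dual ℂ H) 𝔤 x) (LinearMap.inr ℂ (Dual ℂ H) 𝔤 y) := by
    intro x y; simp
  rw [schoutenLie_eq, map_schoutenWith hf, inclBivector]

/-- Constant vector fields bracket to zero with constant sections, so only `x` acts on `Q` and `v`
survives as a wedge factor; moving it to the front costs the sign. -/
theorem schoutenWith_wedge2_inclBivector (x : 𝔤) (v : Dual ℂ H) (Q : ⋀[ℂ]^2 𝔤) :
    schoutenWith (fibreBracket H) (wedge2 ((0, x) : Fibre H) (v, 0)) (inclBivector H Q) =
      -wedge12 ((v, 0) : Fibre H) (inclBivector H (adBivector x Q)) := by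
  induction Q using bivector_induction with
  | wedge a b =>
    refine trivector_ext fun ξ η ζ => ?_
    have h0 : ((0, 0) : Fibre H) = 0 := rfl
    simp only [inclBivector, map_wedge2, schoutenWith_wedge2, ev3_schoutenDecompWith, ev3_wedge3,
      adBivector_wedge2, map_add, wedge12_add, wedge12_wedge2, ev3_neg, ev3_add,
      fibreBracket_apply, LinearMap.inr_apply, zero_lie, h0, map_zero]
    ring
  | add P Q hP hQ => simp only [map_add, hP, hQ, adBivector_add, wedge12_add]; abel
  | smul c P hP => simp only [map_smul, hP, adBivector_smul, wedge12_smul, smul_neg]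

theorem schoutenWith_wedge2_of_commute (x y : 𝔤) (h : ⁅x, y⁆ = 0) (v w : Dual ℂ H) :
    schoutenWith (fibreBracket H) (wedge2 ((0, x) : Fibre H) (v, 0))
      (wedge2 ((0, y) : Fibre H) (w, 0)) = 0 := by
  have h0 : ((0, 0) : Fibre H) = 0 := rfl
  simp [schoutenDecompWith, h, h0]

/-- The components of a trivector in `⋀³ 𝔤` and `𝔥* ⊗ ⋀² 𝔤` are independent. -/
theorem map_add_sum_wedge12_eq_zero_iff {ι : Type*} [Fintype ι] (v : Basis ι ℂ (Dual ℂ H))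
    (T : ⋀[ℂ]^3 𝔤) (Q : ι → ⋀[ℂ]^2 𝔤) :
    exteriorPower.map 3 (LinearMap.inr ℂ (Dual ℂ H) 𝔤) T -
      ∑ i, wedge12 ((v i, 0) : Fibre H) (inclBivector H (Q i)) = 0 ↔ T = 0 ∧ ∀ i, Q i = 0 := by
  classical
  refine ⟨fun h => ?_, fun ⟨hT, hQ⟩ => by simp [hT, hQ]⟩
  have hT : T = 0 := by
    -- Projection to `𝔤` kills every term with a factor in `𝔥*` and leaves `T`.
    have h1 := congrArg (exteriorPower.map 3 (LinearMap.snd ℂ (Dual ℂ H) 𝔤)) h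
    have h2 : ∀ (i : ι) (R : ⋀[ℂ]^2 𝔤), wedge12 (0 : 𝔤) R = 0 := fun _ R => by
      simpa using wedge12_smul_left (0 : ℂ) (0 : 𝔤) R
    have h3 : exteriorPower.map 3 (LinearMap.snd ℂ (Dual ℂ H) 𝔤)
        (exteriorPower.map 3 (LinearMap.inr ℂ (Dual ℂ H) 𝔤) T) = T := by
      rw [← LinearMap.comp_apply, ← exteriorPower.map_comp, LinearMap.snd_comp_inr,
        exteriorPower.map_id, LinearMap.id_apply]
    rw [map_sub, h3, map_sum, map_zero] at h1
    rw [← h1, eq_comm, sub_eq_self]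
    refine Finset.sum_eq_zero fun i _ => ?_
    rw [map_wedge12]
    exact h2 i _
  refine ⟨hT, fun i => bivector_ext fun η ζ => ?_⟩
  rw [hT, map_zero, zero_sub, neg_eq_zero] at h
  -- One dual basis covector of `𝔥*` together with two covectors pulled back from `𝔤` isolates `Q
  -- i`.
  have h1 := congrArg (fun S => ev3 S (v.coord i ∘ₗ LinearMap.fst ℂ (Dual ℂ H) 𝔤)
    (η ∘ₗ LinearMap.snd ℂ (Dual ℂ H) 𝔤) (ζ ∘ₗ LinearMap.snd ℂ (Dual ℂ H) 𝔤)) h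
  simpa [ev3_wedge12, inclBivector, ev2_map, LinearMap.comp_assoc, Finsupp.single_apply] using h1

end LieAlg

set_option linter.unusedSectionVars false

variable {𝔤 : Type*} [LieRing 𝔤] [LieAlgebra ℂ 𝔤] [Module.Finite ℂ 𝔤] [IsKilling ℂ 𝔤]
  {H : LieSubalgebra ℂ 𝔤} [H.IsCartanSubalgebra]

/-! ### Derivatives of holomorphic functions on `𝔥*` -/

section Derivative

variable {W W' : Type*} [AddCommGroup W] [Module ℂ W] [AddCommGroup W'] [Module ℂ W']

/-- The linear map `D` is the derivative at `x` of the function `f` on `𝔥*`. -/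
def IsDerivAt (f : Dual ℂ H → W) (x : Dual ℂ H) (D : Dual ℂ H →ₗ[ℂ] W) : Prop :=
  ∀ (φ : Dual ℂ W) (v : Dual ℂ H), lineDeriv ℂ (fun y => φ (f y)) x v = φ (D v)

theorem IsDerivAt.const_add_map {f : Dual ℂ H → W} {x : Dual ℂ H} {D : Dual ℂ H →ₗ[ℂ] W}
    (h : IsDerivAt f x D) (c : W') (F : W →ₗ[ℂ] W') :
    IsDerivAt (fun y => c + F (f y)) x (F ∘ₗ D) := by
  intro φ v
  have := h (φ ∘ₗ F) v
  simp only [lineDeriv, LinearMap.comp_apply, map_add] at this ⊢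
  rw [← this]
  exact deriv_const_add _

theorem IsDerivAt.dirDeriv_eq [Module.Finite ℂ W] {f : Dual ℂ H → W} {x : Dual ℂ H}
    {D : Dual ℂ H →ₗ[ℂ] W} (h : IsDerivAt f x D) (v : Dual ℂ H) : dirDeriv f x v = D v := by
  rw [dirDeriv, ← (finBasis ℂ W).sum_repr (D v)]
  exact Finset.sum_congr rfl fun j _ => by
    rw [show lineDeriv ℂ (fun y => (finBasis ℂ W).repr (f y) j) x v = _ from
      h ((finBasis ℂ W).coord j) v, Basis.coord_apply]

theorem HolomorphicOn.const_add {b : (rootSystem H).Base} {f : Dual ℂ H → W}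
    {U : Set (Dual ℂ H)} (hf : HolomorphicOn b f U) (c : W) :
    HolomorphicOn b (fun y => c + f y) U := fun φ => by
  simp only [map_add]
  exact (hf φ).const_add _

/-- Line derivatives need not be linear in the direction. Holomorphy on an open set gives Fréchet
derivatives of the components, and these assemble into a linear map. -/
theorem HolomorphicOn.exists_isDerivAt [Module.Finite ℂ W] {b : (rootSystem H).Base}
    {f : Dual ℂ H → W} {U : Set (Dual ℂ H)} (hf : HolomorphicOn b f U) (hU : IsOpenInDual b U)
    {x : Dual ℂ H} (hx : x ∈ U) : ∃ D, IsDerivAt f x D := by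
  have hdiff : ∀ φ : Dual ℂ W,
      DifferentiableAt ℂ (fun z => φ (f ((coords b).symm z))) (coords b x) := fun φ =>
    (hf φ).differentiableAt (hU.mem_nhds (by simpa using hx))
  have hline : ∀ (φ : Dual ℂ W) v, lineDeriv ℂ (fun y => φ (f y)) x v =
      fderiv ℂ (fun z => φ (f ((coords b).symm z))) (coords b x) (coords b v) := by
    intro φ v
    rw [← (hdiff φ).lineDeriv_eq_fderiv]
    simp [lineDeriv]
  let e := finBasis ℂ W
  refine ⟨∑ j, ((fderiv ℂ (fun z => e.coord j (f ((coords b).symm z))) (coords b x) :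
    (b.support → ℂ) →ₗ[ℂ] ℂ) ∘ₗ (coords b : Dual ℂ H →ₗ[ℂ] _)).smulRight (e j), fun φ v => ?_⟩
  rw [hline]
  have hφ : (fun z => φ (f ((coords b).symm z))) =
      fun z => ∑ j, φ (e j) * e.coord j (f ((coords b).symm z)) := by
    ext z
    conv_lhs => rw [← e.sum_repr (f ((coords b).symm z))]
    simp only [map_sum, map_smul, smul_eq_mul, Basis.coord_apply, mul_comm]
  have hd := HasFDerivAt.fun_sum (u := Finset.univ) fun j _ =>
    (hdiff (e.coord j)).hasFDerivAt.const_mul (φ (e j))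
  rw [hφ, hd.fderiv]
  simp [LinearMap.sum_apply, mul_comm]

/-- Differentiability of `g` is not needed: over a field `deriv` commutes with multiplication by a
constant, even where it takes its default value. -/
theorem dirDeriv_smul_const [Module.Finite ℂ W] (g : Dual ℂ H → ℂ) (w : W) (x v : Dual ℂ H) :
    dirDeriv (fun y => g y • w) x v = lineDeriv ℂ g x v • w := by
  rw [dirDeriv]
  conv_rhs => rw [← (finBasis ℂ W).sum_repr w, Finset.smul_sum]
  refine Finset.sum_congr rfl fun j _ => ?_
  rw [smul_smul]
  congr 1
  simp only [map_smul, Finsupp.smul_apply, smul_eq_mul, lineDeriv]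
  exact deriv_mul_const_field _

end Derivative

/-! ### The Schouten bracket of sections -/

/-- The Leibniz rule of the algebroid, whose anchor is the first projection. The constant frame
contributes only its pointwise bracket. -/
theorem gaugeBracket_smul_smul (f g : Dual ℂ H → ℂ) (a c : Fibre H) (x : Dual ℂ H) :
    gaugeBracket (fun y => f y • a) (fun y => g y • c) x =
      (f x * g x) • fibreBracket H a c + (f x * lineDeriv ℂ g x a.1) • c
        - (g x * lineDeriv ℂ f x c.1) • a := by
  ext1
  · simp [gaugeBracket, dirDeriv_smul_const, lineDeriv_smul, smul_smul]
  · simp [gaugeBracket, dirDeriv_smul_const, lineDeriv_smul, smul_smul, mul_comm]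

theorem gaugeBracket_smul_const (f : Dual ℂ H → ℂ) (a c : Fibre H) (x : Dual ℂ H) :
    gaugeBracket (fun y => f y • a) (fun _ => c) x =
      f x • fibreBracket H a c - lineDeriv ℂ f x c.1 • a := by
  have := gaugeBracket_smul_smul f (fun _ => 1) a c x
  simpa [lineDeriv] using this

theorem gaugeBracket_const_smul (g : Dual ℂ H → ℂ) (a c : Fibre H) (x : Dual ℂ H) :
    gaugeBracket (fun _ => a) (fun y => g y • c) x =
      g x • fibreBracket H a c + lineDeriv ℂ g x a.1 • c := by
  have := gaugeBracket_smul_smul (fun _ => 1) g a c x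
  simpa [lineDeriv] using this

theorem gaugeBracket_const_const (a c : Fibre H) (x : Dual ℂ H) :
    gaugeBracket (fun _ => a) (fun _ => c) x = fibreBracket H a c := by
  have := gaugeBracket_smul_const (fun _ => 1) a c x
  simpa [lineDeriv] using this

/-- The two derivative terms are exchanged by `(f, a, b) ↔ (g, c, d)`. This symmetry produces the
factor `2` in `schouten_self`. -/
theorem schoutenDecomp_smul (f g : Dual ℂ H → ℂ) (a b c d : Fibre H) (x : Dual ℂ H) :
    schoutenDecomp (fun y => f y • a) (fun _ => b) (fun y => g y • c) (fun _ => d) x =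
      (f x * g x) • schoutenDecompWith (fibreBracket H) a b c d
        + f x • (lineDeriv ℂ g x b.1 • wedge3 a c d - lineDeriv ℂ g x a.1 • wedge3 b c d)
        + g x • (lineDeriv ℂ f x d.1 • wedge3 c a b - lineDeriv ℂ f x c.1 • wedge3 d a b) := by
  rw [schoutenDecomp, gaugeBracket_smul_smul, gaugeBracket_smul_const, gaugeBracket_const_smul,
    gaugeBracket_const_const]
  refine trivector_ext fun ξ η ζ => ?_
  simp only [ev3_add, ev3_sub, ev3_smul, ev3_schoutenDecompWith, ev3_wedge3, map_add, map_sub,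
    map_smul, smul_eq_mul]
  ring

/-- The part of the Schouten bracket of sections that contains the derivatives: contraction of the
bivector `P` with the derivative `D` of a section of `⋀² A`. -/
def anchorPart (D : Dual ℂ H →ₗ[ℂ] ⋀[ℂ]^2 (Fibre H)) (P : ⋀[ℂ]^2 (Fibre H)) : ⋀[ℂ]^3 (Fibre H) :=
  extend2 (fun a b => wedge12 a (D b.1) - wedge12 b (D a.1)) P

theorem anchorPart_wedge2 (D : Dual ℂ H →ₗ[ℂ] ⋀[ℂ]^2 (Fibre H)) (a b : Fibre H) :
    anchorPart D (wedge2 a b) = wedge12 a (D b.1) - wedge12 b (D a.1) := by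
  apply extend2_wedge2_of_alternating (f := fun a b : Fibre H => wedge12 a (D b.1) - wedge12 b (D a.1))
  · intros; simp only [Prod.fst_add, map_add, wedge12_add, wedge12_add_left]; abel
  · intros; simp only [Prod.smul_fst, map_smul, wedge12_smul, wedge12_smul_left, smul_sub]
  · intros; simp only [Prod.fst_add, map_add, wedge12_add, wedge12_add_left]; abel
  · intros; simp only [Prod.smul_fst, map_smul, wedge12_smul, wedge12_smul_left, smul_sub]
  · intros; exact sub_self _

theorem sum_four_swap {ι W : Type*} [Fintype ι] [AddCommMonoid W] (F : ι → ι → ι → ι → W) :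
    ∑ a, ∑ b, ∑ c, ∑ d, F c d a b = ∑ a, ∑ b, ∑ c, ∑ d, F a b c d := by
  have h : ∀ G : ι → ι → ι → ι → W, ∑ a, ∑ b, ∑ c, ∑ d, G a b c d =
      ∑ p : ι × ι, ∑ q : ι × ι, G p.1 p.2 q.1 q.2 := by
    simp [Fintype.sum_prod_type]
  rw [h, h, Finset.sum_comm]

theorem smul_sum_four_add_swap {ι W : Type*} [Fintype ι] [AddCommGroup W] [Module ℂ W] (k : ℂ)
    (S A : ι → ι → ι → ι → W) :
    k • ∑ a, ∑ b, ∑ c, ∑ d, (S a b c d + A a b c d + A c d a b) =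
      k • ∑ a, ∑ b, ∑ c, ∑ d, S a b c d + (2 : ℂ) • k • ∑ a, ∑ b, ∑ c, ∑ d, A a b c d := by
  simp only [Finset.sum_add_distrib, sum_four_swap A]
  module

theorem schoutenWith_eq_sum (B : Fibre H →ₗ[ℂ] Fibre H →ₗ[ℂ] Fibre H) (P : ⋀[ℂ]^2 (Fibre H)) :
    schoutenWith B P P = (1 / 4 : ℂ) • ∑ a, ∑ b, ∑ c, ∑ d, (coeff2 P a b * coeff2 P c d) •
      schoutenDecompWith B (finBasis ℂ (Fibre H) a) (finBasis ℂ (Fibre H) b)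
        (finBasis ℂ (Fibre H) c) (finBasis ℂ (Fibre H) d) := by
  simp only [schoutenWith_apply, extend2, Finset.smul_sum, smul_smul]
  refine Finset.sum_congr rfl fun a _ => Finset.sum_congr rfl fun b _ =>
    Finset.sum_congr rfl fun c _ => Finset.sum_congr rfl fun d _ => ?_
  congr 1
  ring

theorem anchorPart_eq_sum (D : Dual ℂ H →ₗ[ℂ] ⋀[ℂ]^2 (Fibre H)) (P : ⋀[ℂ]^2 (Fibre H)) :
    anchorPart D P = (1 / 4 : ℂ) • ∑ a, ∑ b, ∑ c, ∑ d, coeff2 P a b •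
      (coeff2 (D (finBasis ℂ (Fibre H) b).1) c d • wedge3 (finBasis ℂ (Fibre H) a)
          (finBasis ℂ (Fibre H) c) (finBasis ℂ (Fibre H) d) -
        coeff2 (D (finBasis ℂ (Fibre H) a).1) c d • wedge3 (finBasis ℂ (Fibre H) b)
          (finBasis ℂ (Fibre H) c) (finBasis ℂ (Fibre H) d)) := by
  simp only [anchorPart, wedge12, extend2, Finset.smul_sum, smul_smul, ← Finset.sum_sub_distrib,
    smul_sub]
  refine Finset.sum_congr rfl fun a _ => Finset.sum_congr rfl fun b _ =>
    Finset.sum_congr rfl fun c _ => Finset.sum_congr rfl fun d _ => ?_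
  congr 2 <;> ring

/-- The Schouten bracket of a section with itself, in terms of its value and its derivative. -/
theorem schouten_self {P : Dual ℂ H → ⋀[ℂ]^2 (Fibre H)} {x : Dual ℂ H}
    {D : Dual ℂ H →ₗ[ℂ] ⋀[ℂ]^2 (Fibre H)} (hD : IsDerivAt P x D) :
    schouten P P x = schoutenWith (fibreBracket H) (P x) (P x) + (2 : ℂ) • anchorPart D (P x) := by
  -- Each coefficient is a linear functional of the bivector, so its derivative is read off from
  -- `D`.
  have hc : ∀ a b v, lineDeriv ℂ (fun y => coeff2 (P y) a b) x v = coeff2 (D v) a b :=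
    fun a b v => hD (exteriorPower.pairingDual ℂ (Fibre H) 2 (exteriorPower.ιMulti ℂ 2
      ![(finBasis ℂ (Fibre H)).coord a, (finBasis ℂ (Fibre H)).coord b])) v
  rw [schoutenWith_eq_sum, anchorPart_eq_sum, ← smul_sum_four_add_swap]
  simp only [schouten, schoutenDecomp_smul, hc]

theorem anchorPart_add (D : Dual ℂ H →ₗ[ℂ] ⋀[ℂ]^2 (Fibre H)) (P Q : ⋀[ℂ]^2 (Fibre H)) :
    anchorPart D (P + Q) = anchorPart D P + anchorPart D Q := extend2_add _ _ _

/-- The anchor vanishes on `𝔤`, so a bivector from `⋀² 𝔤` differentiates nothing. -/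
theorem anchorPart_inclBivector (D : Dual ℂ H →ₗ[ℂ] ⋀[ℂ]^2 (Fibre H)) (Q : ⋀[ℂ]^2 𝔤) :
    anchorPart D (inclBivector H Q) = 0 := by
  induction Q using bivector_induction with
  | wedge u v => simp [inclBivector, anchorPart_wedge2]
  | add P Q hP hQ => rw [map_add, anchorPart_add, hP, hQ, add_zero]
  | smul c P hP => rw [map_smul, anchorPart, extend2_smul, ← anchorPart, hP, smul_zero]

/-! ### Brackets with `θ` and the components of the Hamiltonian condition -/

theorem anchorPart_theta (b : (rootSystem H).Base) (D : Dual ℂ H →ₗ[ℂ] ⋀[ℂ]^2 𝔤) :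
    anchorPart (inclBivector H ∘ₗ D) (theta b) =
      exteriorPower.map 3 (LinearMap.inr ℂ (Dual ℂ H) 𝔤)
        (∑ i, wedge12 (simpleH b i : 𝔤) (D (simpleHDual b i))) := by
  rw [theta, anchorPart, extend2_sum, map_sum]
  refine Finset.sum_congr rfl fun i _ => ?_
  rw [← anchorPart, anchorPart_wedge2, map_wedge12]
  simp [inclBivector]

theorem schoutenWith_theta_theta (b : (rootSystem H).Base) :
    schoutenWith (fibreBracket H) (theta b) (theta b) = 0 := by
  have hH : ∀ x y : H, ⁅(x : 𝔤), (y : 𝔤)⁆ = 0 := fun x y => by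
    rw [← LieSubalgebra.coe_bracket, trivial_lie_zero, ZeroMemClass.coe_zero]
  simp only [theta, map_sum, LinearMap.sum_apply]
  exact Finset.sum_eq_zero fun i _ => Finset.sum_eq_zero fun j _ =>
    schoutenWith_wedge2_of_commute _ _ (hH _ _) _ _

theorem schoutenWith_theta_inclBivector (b : (rootSystem H).Base) (Q : ⋀[ℂ]^2 𝔤) :
    schoutenWith (fibreBracket H) (theta b) (inclBivector H Q) =
      -∑ i, wedge12 ((simpleHDual b i, 0) : Fibre H)
        (inclBivector H (adBivector (simpleH b i : 𝔤) Q)) := by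
  simp only [theta, map_sum, LinearMap.sum_apply, schoutenWith_wedge2_inclBivector,
    Finset.sum_neg_distrib]

theorem adBivector_eq_zero_of_simpleH (b : (rootSystem H).Base) {Q : ⋀[ℂ]^2 𝔤}
    (hQ : ∀ i, adBivector (simpleH b i : 𝔤) Q = 0) (h : H) : adBivector (h : 𝔤) Q = 0 := by
  have : ∀ h ∈ Submodule.span ℂ (Set.range (simpleH b)), adBivector (h : 𝔤) Q = 0 := by
    intro h hh
    induction hh using Submodule.span_induction with
    | mem x hx => obtain ⟨i, rfl⟩ := hx; exact hQ i
    | zero => simpa using adBivector_smul_left (0 : ℂ) (0 : 𝔤) Q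
    | add x y _ _ hx hy =>
      rw [show ((x + y : H) : 𝔤) = x + y from rfl, adBivector_add_left, hx, hy, add_zero]
    | smul c x _ hx =>
      rw [show ((c • x : H) : 𝔤) = c • (x : 𝔤) from rfl, adBivector_smul_left, hx, smul_zero]
  exact this h (by rw [(simpleH b).span_eq]; trivial)

/-- The weights of `E_α` and `E_{-α}` cancel in each summand. -/
theorem adBivector_standardR (b : (rootSystem H).Base) (E : RootVectors H) (h : H) :
    adBivector (h : 𝔤) (standardR b E) = 0 := by
  rw [standardR, adBivector_sum]
  refine Finset.sum_eq_zero fun α _ => ?_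
  split_ifs
  · have hα := H.isNonZero_coe_root α
    have h1 : ⁅(h : 𝔤), E.E α.1⁆ = α.1 h • E.E α.1 :=
      lie_eq_smul_of_mem_rootSpace (E.mem_rootSpace _ hα) h
    have h2 : ⁅(h : 𝔤), E.E (-α.1)⁆ = (-α.1) h • E.E (-α.1) :=
      lie_eq_smul_of_mem_rootSpace (E.mem_rootSpace _ hα.neg) h
    rw [adBivector_wedge2, h1, h2, wedge2_smul_left, wedge2_smul_right, ← add_smul]
    simp
  · exact adBivector_zero _

theorem bilin_add_self {V W : Type*} [AddCommGroup V] [Module ℂ V] [AddCommGroup W] [Module ℂ W]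
    (F : V →ₗ[ℂ] V →ₗ[ℂ] W) (s t : V) (h : F t s = F s t) :
    F (s + t) (s + t) = F s s + (2 : ℂ) • F s t + F t t := by
  simp only [map_add, LinearMap.add_apply, h]
  module

set_option maxHeartbeats 2000000 in
/-- The Hamiltonian condition, split into its components in `⋀³ 𝔤` and `𝔥* ⊗ ⋀² 𝔤`. -/
theorem hamiltonian_expression_eq (b : (rootSystem H).Base) (E : RootVectors H)
    {τ : Dual ℂ H → ⋀[ℂ]^2 𝔤} {x : Dual ℂ H} {D : Dual ℂ H →ₗ[ℂ] ⋀[ℂ]^2 𝔤}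
    (hD : IsDerivAt τ x D) :
    dStar (standardR b E) (theta b + inclBivector H (τ x)) + (1 / 2 : ℂ) •
        schouten (fun y => theta b + inclBivector H (τ y))
          (fun y => theta b + inclBivector H (τ y)) x =
      exteriorPower.map 3 (LinearMap.inr ℂ (Dual ℂ H) 𝔤)
        (∑ i, wedge12 (simpleH b i : 𝔤) (D (simpleHDual b i)) +
          schoutenLie (standardR b E) (τ x) + (1 / 2 : ℂ) • schoutenLie (τ x) (τ x)) -
      ∑ i, wedge12 ((simpleHDual b i, 0) : Fibre H)
        (inclBivector H (adBivector (simpleH b i : 𝔤) (τ x))) := by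

  have hD' := hD.const_add_map (theta b) (inclBivector H)
  -- By symmetry this is the bracket of `θ` with `r₀`, which involves only `[h_i, r₀] = 0`.
  have h1 : schoutenWith (fibreBracket H) (inclBivector H (standardR b E)) (theta b) = 0 := by
    rw [schoutenWith_comm fibreBracket_swap, schoutenWith_theta_inclBivector]
    simp [adBivector_standardR]
  have h2 := schoutenWith_theta_inclBivector b (τ x)
  have h3 : anchorPart (inclBivector H ∘ₗ D) (theta b + inclBivector H (τ x)) =
      exteriorPower.map 3 (LinearMap.inr ℂ (Dual ℂ H) 𝔤)
        (∑ i, wedge12 (simpleH b i : 𝔤) (D (simpleHDual b i))) := by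
    rw [anchorPart_add, anchorPart_inclBivector (inclBivector H ∘ₗ D) (τ x), add_zero,
      anchorPart_theta]
  have h4 := bilin_add_self (schoutenWith (fibreBracket H)) (theta b) (inclBivector H (τ x))
    (schoutenWith_comm fibreBracket_swap _ _)
  have h5 : dStar (standardR b E) (theta b + inclBivector H (τ x)) = _ :=
    (dStar_eq_schoutenWith _ _).trans (map_add _ _ _)
  have h6 := schoutenWith_inclBivector (H := H) (standardR b E) (τ x)
  have h7 := schoutenWith_inclBivector (H := H) (τ x) (τ x)
  rw [h1, h6, zero_add] at h5
  rw [schoutenWith_theta_theta, zero_add, h2, h7] at h4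
  rw [h5, schouten_self hD', h4, h3, map_add, map_add, map_smul]
  -- What remains is a linear identity between four trivectors.
  generalize exteriorPower.map 3 (LinearMap.inr ℂ (Dual ℂ H) 𝔤)
    (∑ i, wedge12 (simpleH b i : 𝔤) (D (simpleHDual b i))) = A₁
  generalize exteriorPower.map 3 (LinearMap.inr ℂ (Dual ℂ H) 𝔤)
    (schoutenLie (standardR b E) (τ x)) = A₂
  generalize exteriorPower.map 3 (LinearMap.inr ℂ (Dual ℂ H) 𝔤) (schoutenLie (τ x) (τ x)) = A₃
  generalize ∑ i, wedge12 ((simpleHDual b i, 0) : Fibre H)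
        (inclBivector H (adBivector (simpleH b i : 𝔤) (τ x))) = A₄
  module

/-! ### Signs of weights -/

/-- The root given by a nonzero weight. -/
def rootOf (α : Weight ℂ H 𝔤) (hα : α.IsNonZero) : H.root := ⟨α, by simpa using hα⟩

theorem isPos_rootOf_neg (b : (rootSystem H).Base) (α : Weight ℂ H 𝔤) (hα : α.IsNonZero) :
    b.IsPos (rootOf (-α) hα.neg) ↔ ¬ b.IsPos (rootOf α hα) := by
  have hroot : rootOf (-α) hα.neg = (rootSystem H).reflectionPerm (rootOf α hα) (rootOf α hα) := by
    apply (rootSystem H).root.injective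
    rw [RootPairing.root_reflectionPerm, RootPairing.reflection_apply_self]
    simp [rootOf]
  rw [hroot]
  exact RootPairing.Base.IsPos.neg_iff_not b _

/-- Here `-γ = α + β` is a root and a sum of positive roots, hence positive. -/
theorem isPos_rootOf_add (b : (rootSystem H).Base) {α β γ : Weight ℂ H 𝔤} (hα : α.IsNonZero)
    (hβ : β.IsNonZero) (hγ : γ.IsNonZero) (h : (α + β + γ : H → ℂ) = 0)
    (pα : b.IsPos (rootOf α hα)) (pβ : b.IsPos (rootOf β hβ)) : ¬ b.IsPos (rootOf γ hγ) := by
  rw [← isPos_rootOf_neg]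
  refine pα.add pβ ?_
  ext x
  have := congrFun h x
  simp only [Pi.add_apply, Pi.zero_apply] at this
  simp only [rootOf, rootSystem_root_apply, Weight.toLinear_neg, LinearMap.neg_apply,
    LinearMap.add_apply, Weight.toLinear_apply]
  linear_combination -this

open scoped Classical in
/-- The sign of a weight: `1` on positive roots, `-1` on negative roots, `0` on the zero weight. -/
def weightSign (b : (rootSystem H).Base) (α : Weight ℂ H 𝔤) : ℂ :=
  if hα : α.IsNonZero then if b.IsPos (rootOf α hα) then 1 else -1 else 0

theorem weightSign_of_isZero (b : (rootSystem H).Base) {α : Weight ℂ H 𝔤} (hα : α.IsZero) :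
    weightSign b α = 0 := dif_neg fun h => h hα

theorem weightSign_of_isPos (b : (rootSystem H).Base) {α : Weight ℂ H 𝔤} (hα : α.IsNonZero)
    (p : b.IsPos (rootOf α hα)) : weightSign b α = 1 := by
  rw [weightSign, dif_pos hα, if_pos p]

theorem weightSign_of_not_isPos (b : (rootSystem H).Base) {α : Weight ℂ H 𝔤} (hα : α.IsNonZero)
    (p : ¬ b.IsPos (rootOf α hα)) : weightSign b α = -1 := by
  rw [weightSign, dif_pos hα, if_neg p]

theorem weightSign_mul_of_add_eq_zero (b : (rootSystem H).Base) {α β : Weight ℂ H 𝔤}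
    (hα : α.IsNonZero) (h : (α + β : H → ℂ) = 0) : weightSign b α * weightSign b β = -1 := by
  have hβ : β = -α := by
    ext x
    have := congrFun h x
    simp only [Pi.add_apply, Pi.zero_apply] at this
    simp only [Weight.coe_neg, Pi.neg_apply]
    linear_combination this
  subst hβ
  by_cases p : b.IsPos (rootOf α hα)
  · rw [weightSign_of_isPos b hα p, weightSign_of_not_isPos b hα.neg
      (by rw [isPos_rootOf_neg]; simpa using p)]
    norm_num
  · rw [weightSign_of_not_isPos b hα p, weightSign_of_isPos b hα.neg
      (by rw [isPos_rootOf_neg]; simpa using p)]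
    norm_num

/-- If one weight is zero, the other two are opposite roots and only their product `-1` remains. If
none is zero, the signs cannot all agree, and two equal signs with one opposite give `1 - 1 - 1`.
For three zero weights the sum would be `0`, whence `hne`. -/
theorem weightSign_identity (b : (rootSystem H).Base) {α β γ : Weight ℂ H 𝔤}
    (h : (α + β + γ : H → ℂ) = 0) (hne : ¬ (α.IsZero ∧ β.IsZero)) :
    weightSign b α * weightSign b β + weightSign b β * weightSign b γ
      + weightSign b γ * weightSign b α = -1 := by
  by_cases hα : α.IsZero
  · have hα' : (α : H → ℂ) = 0 := hα
    have hβ : β.IsNonZero := fun hβ => hne ⟨hα, hβ⟩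
    rw [weightSign_of_isZero b hα, weightSign_mul_of_add_eq_zero b hβ (by simpa [hα'] using h)]
    ring
  by_cases hβ : β.IsZero
  · have hβ' : (β : H → ℂ) = 0 := hβ
    rw [weightSign_of_isZero b hβ, mul_comm (weightSign b γ),
      weightSign_mul_of_add_eq_zero b hα (by simpa [hβ'] using h)]
    ring
  by_cases hγ : γ.IsZero
  · have hγ' : (γ : H → ℂ) = 0 := hγ
    rw [weightSign_of_isZero b hγ, weightSign_mul_of_add_eq_zero b hα (by simpa [hγ'] using h)]
    ring
  -- The case of negative roots follows from `isPos_rootOf_add` by negating all three weights.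
  have key : ∀ {α β γ : Weight ℂ H 𝔤} (hα : α.IsNonZero) (hβ : β.IsNonZero) (hγ : γ.IsNonZero),
      (α + β + γ : H → ℂ) = 0 →
      ¬ b.IsPos (rootOf α hα) → ¬ b.IsPos (rootOf β hβ) → b.IsPos (rootOf γ hγ) := by
    intro α β γ hα hβ hγ h pα pβ
    rw [← isPos_rootOf_neg] at pα pβ
    have := isPos_rootOf_add b hα.neg hβ.neg hγ.neg (by
      simp only [Weight.coe_neg]; rw [← neg_add, ← neg_add, h, neg_zero]) pα pβ
    rw [isPos_rootOf_neg] at this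
    simpa using this
  by_cases pα : b.IsPos (rootOf α hα) <;> by_cases pβ : b.IsPos (rootOf β hβ) <;>
    by_cases pγ : b.IsPos (rootOf γ hγ)
  · exact absurd pγ (isPos_rootOf_add b hα hβ hγ h pα pβ)
  · rw [weightSign_of_isPos b hα pα, weightSign_of_isPos b hβ pβ,
      weightSign_of_not_isPos b hγ pγ]; ring
  · rw [weightSign_of_isPos b hα pα, weightSign_of_not_isPos b hβ pβ,
      weightSign_of_isPos b hγ pγ]; ring
  · rw [weightSign_of_isPos b hα pα, weightSign_of_not_isPos b hβ pβ,
      weightSign_of_not_isPos b hγ pγ]; ring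
  · rw [weightSign_of_not_isPos b hα pα, weightSign_of_isPos b hβ pβ,
      weightSign_of_isPos b hγ pγ]; ring
  · rw [weightSign_of_not_isPos b hα pα, weightSign_of_isPos b hβ pβ,
      weightSign_of_not_isPos b hγ pγ]; ring
  · rw [weightSign_of_not_isPos b hα pα, weightSign_of_not_isPos b hβ pβ,
      weightSign_of_isPos b hγ pγ]; ring
  · exact absurd (key hα hβ hγ h pα pβ) pγ

/-! ### The map `r₀^♯` -/

theorem killingForm_rootVectors_eq_zero (E : RootVectors H) {β α : Weight ℂ H 𝔤} {x : 𝔤}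
    (hx : x ∈ rootSpace H β) (hα : α.IsNonZero) (h : β ≠ -α) : killingForm ℂ 𝔤 x (E.E α) = 0 := by
  refine killingForm_apply_eq_zero_of_mem_rootSpace_of_add_ne_zero ℂ 𝔤 H hx
    (E.mem_rootSpace α hα) fun h0 => h ?_
  ext y
  have := congrFun h0 y
  simp only [Pi.add_apply, Pi.zero_apply] at this
  simp only [Weight.coe_neg, Pi.neg_apply]
  linear_combination this

/-- Among the root vectors, `x` pairs only with `E_{-β}`. For `β > 0` this is the second factor of
the summand `α = β`, giving `-x`; for `β < 0` it is the first factor of the summand `α = -β`, giving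
`x`. -/
theorem sharp_standardR (b : (rootSystem H).Base) (E : RootVectors H) (β : Weight ℂ H 𝔤) {x : 𝔤}
    (hx : x ∈ rootSpace H β) :
    sharp (standardR b E) (killingForm ℂ 𝔤 x) = -weightSign b β • x := by
  classical
  have hsum : sharp (standardR b E) (killingForm ℂ 𝔤 x) =
      (∑ α : H.root, if b.IsPos α then killingForm ℂ 𝔤 x (E.E α.1) • E.E (-α.1) else 0) -
        ∑ α : H.root, if b.IsPos α then killingForm ℂ 𝔤 x (E.E (-α.1)) • E.E α.1 else 0 := by
    rw [standardR, sharp_sum, ← Finset.sum_sub_distrib]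
    refine Finset.sum_congr rfl fun α _ => ?_
    split_ifs
    · exact sharp_wedge2 _ _ _
    · rw [sub_zero]; exact extend2_zero _
  have hz : ∀ α : H.root, β ≠ -α.1 → killingForm ℂ 𝔤 x (E.E α.1) = 0 := fun α h =>
    killingForm_rootVectors_eq_zero E hx (H.isNonZero_coe_root α) h
  have hz' : ∀ α : H.root, β ≠ α.1 → killingForm ℂ 𝔤 x (E.E (-α.1)) = 0 := fun α h =>
    killingForm_rootVectors_eq_zero E hx (H.isNonZero_coe_root α).neg (by simpa using h)
  by_cases hβ : β.IsZero
  · rw [hsum, weightSign_of_isZero b hβ, neg_zero, zero_smul, sub_eq_zero]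
    rw [Finset.sum_eq_zero, Finset.sum_eq_zero]
    · intro α _
      rw [hz' α fun h => H.isNonZero_coe_root α (h ▸ hβ), zero_smul, ite_self]
    · intro α _
      rw [hz α fun h => (H.isNonZero_coe_root α).neg (h ▸ hβ), zero_smul, ite_self]
  have hβ : β.IsNonZero := hβ
  -- Root spaces are lines, and `E_β ≠ 0` because it pairs to `1` with `E_{-β}`.
  obtain ⟨c, rfl⟩ : ∃ c : ℂ, c • E.E β = x := by
    have hE : (⟨E.E β, E.mem_rootSpace β hβ⟩ : rootSpace H β) ≠ 0 := fun h0 => by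
      have h1 : E.E β = 0 := congrArg Subtype.val h0
      have := E.killing_eq_one β hβ
      simp [h1] at this
    obtain ⟨c, hc⟩ := exists_smul_eq_of_finrank_eq_one (finrank_rootSpace_eq_one β hβ) hE ⟨x, hx⟩
    exact ⟨c, congrArg Subtype.val hc⟩
  have h1 : (∑ α : H.root, if b.IsPos α then
      killingForm ℂ 𝔤 (c • E.E β) (E.E α.1) • E.E (-α.1) else 0) =
      if b.IsPos (rootOf β hβ) then 0 else c • E.E β := by
    rw [Finset.sum_eq_single (rootOf (-β) hβ.neg)]
    · change (if b.IsPos (rootOf (-β) hβ.neg) then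
        killingForm ℂ 𝔤 (c • E.E β) (E.E (-β)) • E.E (- -β) else 0) = _
      rw [neg_neg, map_smul, LinearMap.smul_apply, E.killing_eq_one β hβ, smul_eq_mul, mul_one]
      by_cases p : b.IsPos (rootOf β hβ)
      · rw [if_pos p, if_neg (by rw [isPos_rootOf_neg]; simpa using p)]
      · rw [if_neg p, if_pos (by rw [isPos_rootOf_neg]; simpa using p)]
    · intro α _ hα
      rw [hz α fun h => hα (Subtype.ext (by simp [rootOf, h])), zero_smul, ite_self]
    · simp
  have h2 : (∑ α : H.root, if b.IsPos α then
      killingForm ℂ 𝔤 (c • E.E β) (E.E (-α.1)) • E.E α.1 else 0) =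
      if b.IsPos (rootOf β hβ) then c • E.E β else 0 := by
    rw [Finset.sum_eq_single (rootOf β hβ)]
    · change (if b.IsPos (rootOf β hβ) then
        killingForm ℂ 𝔤 (c • E.E β) (E.E (-β)) • E.E β else 0) = _
      rw [map_smul, LinearMap.smul_apply, E.killing_eq_one β hβ, smul_eq_mul, mul_one]
    · intro α _ hα
      rw [hz' α fun h => hα (Subtype.ext (by simp [rootOf, h])), zero_smul, ite_self]
    · simp
  rw [hsum, h1, h2]
  by_cases p : b.IsPos (rootOf β hβ)
  · rw [weightSign_of_isPos b hβ p, if_pos p, if_pos p]; simp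
  · rw [weightSign_of_not_isPos b hβ p, if_neg p, if_neg p]; simp

/-! ### The modified Yang-Baxter equation for `r₀` and the Casimir element -/

omit [IsKilling ℂ 𝔤] in
theorem weight_induction {p : 𝔤 → Prop} (zero : p 0)
    (mem : ∀ (α : Weight ℂ H 𝔤), ∀ x ∈ rootSpace H α, p x)
    (add : ∀ x y, p x → p y → p (x + y)) (x : 𝔤) : p x := by
  have hx : x ∈ ⨆ α : Weight ℂ H 𝔤, (rootSpace H α).toSubmodule := by
    rw [← LieSubmodule.iSup_toSubmodule, iSup_genWeightSpace_eq_top']; trivial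
  exact Submodule.iSup_induction (fun α : Weight ℂ H 𝔤 => (rootSpace H α).toSubmodule)
    (motive := p) hx mem zero add

/-- The map `r^♯` precomposed with the isomorphism `𝔤 → 𝔤*` given by the Killing form. -/
def killingSharp (r : ⋀[ℂ]^2 𝔤) : 𝔤 →ₗ[ℂ] 𝔤 where
  toFun x := sharp r (killingForm ℂ 𝔤 x)
  map_add' x y := by
    simp only [sharp, ← extend2_fun_add, map_add, LinearMap.add_apply, add_smul]
    congr 1; ext1 a; ext1 c; abel
  map_smul' c x := by
    simp only [sharp, ← extend2_fun_smul, map_smul, LinearMap.smul_apply, smul_sub, smul_smul,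
      smul_eq_mul, RingHom.id_apply]

omit [Module.Finite ℂ 𝔤] [IsKilling ℂ 𝔤] in
theorem killingForm_lie_cyclic (x y z : 𝔤) :
    killingForm ℂ 𝔤 x ⁅y, z⁆ = killingForm ℂ 𝔤 ⁅x, y⁆ z :=
  (LieModule.traceForm_apply_lie_apply ℂ 𝔤 𝔤 x y z).symm

omit [Module.Finite ℂ 𝔤] [IsKilling ℂ 𝔤] in
theorem killingForm_comm (x y : 𝔤) : killingForm ℂ 𝔤 x y = killingForm ℂ 𝔤 y x :=
  LieModule.traceForm_comm ℂ 𝔤 𝔤 x y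

/-- The modified Yang-Baxter equation for `r₀`. -/
theorem standardR_cybe (b : (rootSystem H).Base) (E : RootVectors H) (x y z : 𝔤) :
    killingForm ℂ 𝔤 x ⁅killingSharp (standardR b E) y, killingSharp (standardR b E) z⁆ +
      killingForm ℂ 𝔤 y ⁅killingSharp (standardR b E) z, killingSharp (standardR b E) x⁆ +
      killingForm ℂ 𝔤 z ⁅killingSharp (standardR b E) x, killingSharp (standardR b E) y⁆ =
      -killingForm ℂ 𝔤 ⁅x, y⁆ z := by
  generalize hR : killingSharp (standardR b E) = R
  induction x using weight_induction (H := H) with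
  | zero => simp
  | add x x' hx hx' =>
    simp only [map_add, add_lie, lie_add, LinearMap.add_apply]; linear_combination hx + hx'
  | mem α x hx =>
  induction y using weight_induction (H := H) with
  | zero => simp
  | add x x' hx hx' =>
    simp only [map_add, add_lie, lie_add, LinearMap.add_apply]; linear_combination hx + hx'
  | mem β y hy =>
  induction z using weight_induction (H := H) with
  | zero => simp
  | add x x' hx hx' =>
    simp only [map_add, add_lie, lie_add, LinearMap.add_apply]; linear_combination hx + hx'
  | mem γ z hz =>
  have hRx : R x = -weightSign b α • x := hR ▸ sharp_standardR b E α hx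
  have hRy : R y = -weightSign b β • y := hR ▸ sharp_standardR b E β hy
  have hRz : R z = -weightSign b γ • z := hR ▸ sharp_standardR b E γ hz
  -- By invariance the three cyclic terms are multiples of the one number `⟨[x, y], z⟩`, which
  -- leaves a scalar identity between signs.
  have c1 : killingForm ℂ 𝔤 x ⁅y, z⁆ = killingForm ℂ 𝔤 ⁅x, y⁆ z := killingForm_lie_cyclic x y z
  have c2 : killingForm ℂ 𝔤 z ⁅x, y⁆ = killingForm ℂ 𝔤 ⁅x, y⁆ z := killingForm_comm _ _
  have c3 : killingForm ℂ 𝔤 y ⁅z, x⁆ = killingForm ℂ 𝔤 ⁅x, y⁆ z := by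
    rw [killingForm_lie_cyclic, killingForm_comm, c1]
  simp only [hRx, hRy, hRz, smul_lie, lie_smul, map_smul, smul_eq_mul, c1, c2, c3]
  suffices h : killingForm ℂ 𝔤 ⁅x, y⁆ z = 0 ∨ weightSign b α * weightSign b β +
      weightSign b β * weightSign b γ + weightSign b γ * weightSign b α = -1 by
    rcases h with h | h
    · simp [h]
    · linear_combination killingForm ℂ 𝔤 ⁅x, y⁆ z * h
  have hxy : ⁅x, y⁆ ∈ rootSpace H (α + β) := lie_mem_genWeightSpace_of_mem_genWeightSpace hx hy
  by_cases hsum : (α + β + γ : H → ℂ) = 0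
  · by_cases hne : α.IsZero ∧ β.IsZero
    -- The sign identity fails for three zero weights, but then `x` and `y` lie in the abelian
    -- algebra `𝔥` and `[x, y] = 0`.
    · left
      have hxH : x ∈ H := by
        have : x ∈ rootSpace H (0 : H → ℂ) := by rw [← show (α : H → ℂ) = 0 from hne.1]; exact hx
        simpa using this
      have hyH : y ∈ H := by
        have : y ∈ rootSpace H (0 : H → ℂ) := by rw [← show (β : H → ℂ) = 0 from hne.2]; exact hy
        simpa using this
      have h0 : ⁅x, y⁆ = 0 := congrArg Subtype.val (trivial_lie_zero H H ⟨x, hxH⟩ ⟨y, hyH⟩)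
      simp [h0]
    · exact Or.inr (weightSign_identity b hsum hne)
  · exact Or.inl (killingForm_apply_eq_zero_of_mem_rootSpace_of_add_ne_zero ℂ 𝔤 H hxy hz hsum)

/-- Contracting the outer factors against dual bases reproduces `x` and `z`, leaving `⟨y, [x, z]⟩`;
invariance does the rest. -/
theorem tensorEval_casimirBracket (x y z : 𝔤) :
    tensorEval (killingForm ℂ 𝔤 x) (killingForm ℂ 𝔤 y) (killingForm ℂ 𝔤 z) (casimirBracket 𝔤) =
      -killingForm ℂ 𝔤 ⁅x, y⁆ z := by
  set e := finBasis ℂ 𝔤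
  set e' := LinearMap.BilinForm.dualBasis (killingForm ℂ 𝔤)
    (IsKilling.killingForm_nondegenerate ℂ 𝔤) e with he'
  have hx : ∑ i, killingForm ℂ 𝔤 x (e i) • e' i = x := by
    conv_rhs => rw [← e'.sum_repr x]
    simp [he']
  have hz : ∑ j, killingForm ℂ 𝔤 z (e' j) • e j = z := by
    refine (LinearMap.BilinForm.toDual (killingForm ℂ 𝔤)
      (IsKilling.killingForm_nondegenerate ℂ 𝔤)).injective (e'.ext fun j => ?_)
    simp [LinearMap.BilinForm.toDual_def, he', killingForm_comm (e _),
      LinearMap.BilinForm.apply_dualBasis_left, LinearMap.sum_apply]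
  calc _ = killingForm ℂ 𝔤 y ⁅∑ i, killingForm ℂ 𝔤 x (e i) • e' i,
        ∑ j, killingForm ℂ 𝔤 z (e' j) • e j⁆ := by
        rw [sum_lie_sum]
        simp only [casimirBracket, map_sum, tensorEval_tprod, smul_lie, lie_smul, map_smul,
          smul_eq_mul]
        refine Finset.sum_congr rfl fun i _ => Finset.sum_congr rfl fun j _ => ?_
        simp
        ring
    _ = _ := by
        rw [hx, hz, killingForm_lie_cyclic, ← lie_skew, map_neg, LinearMap.neg_apply]

/-- `½ [r₀, r₀] = [Ω¹², Ω²³]`. -/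
theorem toTensorPower_schoutenLie_standardR (b : (rootSystem H).Base) (E : RootVectors H) :
    exteriorPower.toTensorPower ℂ 𝔤 3
      ((1 / 2 : ℂ) • schoutenLie (standardR b E) (standardR b E)) = casimirBracket 𝔤 := by
  refine tensor_ext (finBasis ℂ 𝔤) fun i j k => ?_
  -- Nondegeneracy writes every covector as `⟨x, ·⟩`, the form in which `standardR_cybe` applies.
  have hdual : ∀ ξ : Dual ℂ 𝔤, ∃ x, killingForm ℂ 𝔤 x = ξ := fun ξ =>
    (LinearMap.BilinForm.toDual (killingForm ℂ 𝔤)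
      (IsKilling.killingForm_nondegenerate ℂ 𝔤)).surjective ξ
  obtain ⟨x, hx⟩ := hdual ((finBasis ℂ 𝔤).coord i)
  obtain ⟨y, hy⟩ := hdual ((finBasis ℂ 𝔤).coord j)
  obtain ⟨z, hz⟩ := hdual ((finBasis ℂ 𝔤).coord k)
  -- For equal arguments the six terms of `ev3_schoutenWith` coincide in pairs, which absorbs the
  -- factor `½`.
  rw [← hx, ← hy, ← hz, tensorEval_toTensorPower, tensorEval_casimirBracket,
    ← standardR_cybe b E, ev3_smul, schoutenLie_eq,
    ev3_schoutenWith fun x y => (lie_skew x y).symm]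
  simp only [lieBilin_apply, killingSharp, LinearMap.coe_mk, AddHom.coe_mk]
  ring

/-! ### Hamiltonian operators and dynamical `r`-matrices -/

omit [IsKilling ℂ 𝔤] in
theorem schoutenLie_add_self (P Q : ⋀[ℂ]^2 𝔤) :
    schoutenLie (P + Q) (P + Q) =
      schoutenLie P P + (2 : ℂ) • schoutenLie P Q + schoutenLie Q Q :=
  bilin_add_self (schoutenWith (lieBilin 𝔤)) P Q
    (schoutenWith_comm (fun x y => (lie_skew x y).symm) _ _)

theorem altD_const_add (b : (rootSystem H).Base) (r : ⋀[ℂ]^2 𝔤) {τ : Dual ℂ H → ⋀[ℂ]^2 𝔤}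
    {x : Dual ℂ H} {D : Dual ℂ H →ₗ[ℂ] ⋀[ℂ]^2 𝔤} (hD : IsDerivAt τ x D) :
    altD b (fun y => r + τ y) x = ∑ i, wedge12 (simpleH b i : 𝔤) (D (simpleHDual b i)) := by
  have hD' : IsDerivAt (fun y => r + τ y) x D := hD.const_add_map r LinearMap.id
  simp only [altD, hD'.dirDeriv_eq]

/-- Coupling constant `2` makes the coefficient `ε²/4` equal to `1`, so the right side cancels
exactly against `½[r₀, r₀]`; injectivity of the embedding brings the equation back to `⋀³ 𝔤`. -/
theorem cdybe_iff (b : (rootSystem H).Base) (E : RootVectors H) (A : ⋀[ℂ]^3 𝔤) (t : ⋀[ℂ]^2 𝔤) :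
    exteriorPower.toTensorPower ℂ 𝔤 3
        (A + (1 / 2 : ℂ) • schoutenLie (standardR b E + t) (standardR b E + t)) =
      ((2 : ℂ) ^ 2 / 4) • casimirBracket 𝔤 ↔
    A + schoutenLie (standardR b E) t + (1 / 2 : ℂ) • schoutenLie t t = 0 := by
  rw [show ((2 : ℂ) ^ 2 / 4) = 1 by norm_num, one_smul,
    ← toTensorPower_schoutenLie_standardR b E, toTensorPower_injective.eq_iff,
    schoutenLie_add_self, ← sub_eq_zero]
  generalize schoutenLie (standardR b E) (standardR b E) = S₁
  generalize schoutenLie (standardR b E) t = S₂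
  generalize schoutenLie t t = S₃
  rw [show A + (1 / 2 : ℂ) • (S₁ + (2 : ℂ) • S₂ + S₃) - (1 / 2 : ℂ) • S₁ =
    A + S₂ + (1 / 2 : ℂ) • S₃ by module]

/-- Since `r₀` has weight zero, `τ` and `r₀ + τ` satisfy the same weight condition, and it may be
tested on the basis `h_i`. -/
theorem hamiltonian_expression_eq_zero_iff (b : (rootSystem H).Base) (E : RootVectors H)
    {τ : Dual ℂ H → ⋀[ℂ]^2 𝔤} {x : Dual ℂ H} {D : Dual ℂ H →ₗ[ℂ] ⋀[ℂ]^2 𝔤}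
    (hD : IsDerivAt τ x D) :
    dStar (standardR b E) (theta b + inclBivector H (τ x)) + (1 / 2 : ℂ) •
        schouten (fun y => theta b + inclBivector H (τ y))
          (fun y => theta b + inclBivector H (τ y)) x = 0 ↔
      (∀ h : H, adBivector (h : 𝔤) (standardR b E + τ x) = 0) ∧
        exteriorPower.toTensorPower ℂ 𝔤 3 (altD b (fun y => standardR b E + τ y) x +
          (1 / 2 : ℂ) • schoutenLie (standardR b E + τ x) (standardR b E + τ x)) =
            ((2 : ℂ) ^ 2 / 4) • casimirBracket 𝔤 := by
  rw [hamiltonian_expression_eq b E hD, map_add_sum_wedge12_eq_zero_iff, altD_const_add b _ hD,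
    cdybe_iff, and_comm]
  refine and_congr_left fun _ => ⟨fun h y => ?_, fun h i => ?_⟩
  · rw [adBivector_add, adBivector_standardR, zero_add]
    exact adBivector_eq_zero_of_simpleH b h y
  · simpa only [adBivector_add, adBivector_standardR, zero_add] using h (simpleH b i)

theorem isHamiltonianOperator_iff (b : (rootSystem H).Base) (E : RootVectors H)
    {U : Set (Dual ℂ H)} (hU : IsOpenInDual b U) {τ : Dual ℂ H → ⋀[ℂ]^2 𝔤}
    (hτ : HolomorphicOn b τ U) :
    IsHamiltonianOperator (standardR b E) U (fun x => theta b + inclBivector H (τ x)) ↔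
      IsDynamicalRMatrix b 2 U (fun x => standardR b E + τ x) := by
  have key : ∀ x ∈ U, _ := fun x hx =>
    hamiltonian_expression_eq_zero_iff b E (hτ.exists_isDerivAt hU hx).choose_spec
  refine ⟨fun h => ⟨hτ.const_add _, fun x hx => ((key x hx).1 (h x hx)).1,
    fun x hx => ((key x hx).1 (h x hx)).2⟩, fun h x hx => (key x hx).2
      ⟨h.zero_weight x hx, h.cdybe x hx⟩⟩

end DynR

end

/-- Simplicity enters only through the nondegeneracy of the Killing form. -/
theorem theorem3p1 {𝔤 : Type*} [LieRing 𝔤] [LieAlgebra ℂ 𝔤] [Module.Finite ℂ 𝔤]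
    [LieAlgebra.IsSimple ℂ 𝔤] (H : LieSubalgebra ℂ 𝔤) [H.IsCartanSubalgebra]
    (b : (LieAlgebra.IsKilling.rootSystem H).Base) (E : DynR.RootVectors H)
    (U : Set (Module.Dual ℂ H)) (hU : DynR.IsOpenInDual b U)
    (τ : Module.Dual ℂ H → ⋀[ℂ]^2 𝔤) (hτ : DynR.HolomorphicOn b τ U) :
    DynR.IsHamiltonianOperator (DynR.standardR b E) U
        (fun x => DynR.theta b + DynR.inclBivector H (τ x)) ↔
      DynR.IsDynamicalRMatrix b 2 U (fun x => DynR.standardR b E + τ x) :=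
  DynR.isHamiltonianOperator_iff b E hU hτ
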